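/- Let $n\ge 3$ and $r\ge 0$ be integers. For a commutative ring $A$ write a point of $(\mathbb{A}^n)^r(A)=(A^n)^r$ as $\mathbf{x}=(\mathbf{x}_1,\dots,\mathbf{x}_r)$ with $\mathbf{x}_k=(x_{1,k},\dots,x_{n,k})\in A^n$. For $\sigma=(i_1,\dots,i_r)\in\mathbb{Z}_{\ge 0}^r$ let $$f_\sigma=\sum_{j=1}^n x_{j,1}^{i_1}x_{j,2}^{i_2}\cdots x_{j,r}^{i_r}\in\mathbb{Z}[\{x_{j,k}\}_{1\le j\le n,\,1\le k\le r}],$$ for $\Sigma\subset\mathbb{Z}_{\ge 0}^r$ let $R_\Sigma$ be the subring generated by the $f_\sigma$, $\sigma\in\Sigma$, and let $F_\Sigma:(\mathbb{A}^n)^r\to\operatorname{Spec}R_\Sigma$ be the natural map; on $A$-points it sends $\mathbf{x}$ to the ring homomorphism $R_\Sigma\to A$, $g\mapsto g(\mathbf{x})$. For an element $x$ of a number field $L$ let $\|x\|$ be the maximum of $|\tau(x)|$ over all embeddings $\tau:L\to\mathbb{C}$, and let $\mathcal{D}_L$ be the absolute value of the discriminant of $L$ over $\mathbb{Q}$. For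 every $\Sigma\subset\mathbb{Z}_{\ge 0}^r$ there is a constant $C>0$, depending only on $n$, $r$ and $\Sigma$, with the following property. Let $\Sigma_0,\Sigma_1\subset\mathbb{Z}_{\ge 0}^r$ be such that $|\Sigma_0|>n/2$, $\Sigma_0+\Sigma_0\subset\Sigma_1$, $\Sigma_1+\Sigma_1\subset\Sigma$, and $\Sigma_1+e_k\subset\Sigma$ for every $1\le k\le r$, where $e_k$ is the $k$-th standard basis vector. Let $K$ be a number field, $d=[K:\mathbb{Q}]$, $\bar K$ an algebraic closure of $K$, and $L/K$ an extension of degree $n$. Then there is an $r$-tuple $(\alpha_1,\dots,\alpha_r)\in\mathcal{O}_L^r$ such that 1. $\|\alpha_k\|\le C\,\mathcal{D}_L^{1/(d(n-2))}$ for every $k$; 2. for every numbering $\rho_1,\dots,\rho_n$ of the $K$-embeddings $L\to\bar K$, if $\phi_L(\alpha_1,\dots,\alpha_r)\in(\bar K^n)^r$ is the point with coordinates $x_{j,k}=\rho_j(\alpha_k)$, then the set of all $\mathbf{x}\in(\mathbb{A}^n)^r(\bar K)$ with $F_\Sigma(\mathbf{x})=F_\Sigma(\phi_L(\alpha_1,\dots,\alpha_r))$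 has at most $(n!)^r$ elements; 3. $L=K(\alpha_1,\dots,\alpha_r)$. -/

import Mathlib

open scoped Pointwise

namespace Multisymmetric

/-- The points of the scheme `(𝔸ⁿ)ʳ` with values in `A`: the `k`-th row `x k : Fin n → A` is an
element of the ring `𝔸ⁿ(A) = Aⁿ`, and `x k j` is the coordinate usually written `x_{j,k}`. -/
abbrev Pts (n r : ℕ) (A : Type*) : Type _ := Fin r → Fin n → A

/-- `χ_σ(x) = x₁ ^ σ₁ ⋯ x_r ^ σ_r`, computed in the ring `Aⁿ`. -/
def chi {n r : ℕ} {A : Type*} [CommRing A] (σ : Fin r → ℕ) (x : Pts n r A) : Fin n → A :=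
  ∏ k, x k ^ σ k

/-- The trace `Tr : Aⁿ → A`, the sum of the coordinates. -/
def tr {n : ℕ} {A : Type*} [CommRing A] (z : Fin n → A) : A := ∑ j, z j

/-- The coordinate ring `ℤ[x_{j,k}]` of `(𝔸ⁿ)ʳ`. -/
abbrev CoordRing (n r : ℕ) : Type := MvPolynomial (Fin n × Fin r) ℤ

/-- The universal point of `(𝔸ⁿ)ʳ`, whose coordinates are the variables `x_{j,k}`. -/
noncomputable def genericPt (n r : ℕ) : Pts n r (CoordRing n r) :=
  fun k j => MvPolynomial.X (j, k)

/-- The multisymmetric function `f_σ = Tr ∘ χ_σ`, as an element of the coordinate ring. -/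
noncomputable def f (n : ℕ) {r : ℕ} (σ : Fin r → ℕ) : CoordRing n r :=
  tr (chi σ (genericPt n r))

/-- `R_Σ`, the subring of the coordinate ring generated by the `f_σ`, `σ ∈ Σ`. -/
noncomputable def R (n : ℕ) {r : ℕ} (S : Set (Fin r → ℕ)) : Subring (CoordRing n r) :=
  Subring.closure (f n '' S)

/-- The map `F_Σ : (𝔸ⁿ)ʳ → Spec R_Σ` on `A`-valued points; an `A`-valued point of `Spec R_Σ` is
a ring homomorphism `R_Σ → A`, and `F_Σ(x)` is evaluation at `x`. -/
noncomputable def F {n r : ℕ} (S : Set (Fin r → ℕ)) {A : Type*} [CommRing A] (x : Pts n r A) :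
    R n S →+* A :=
  (MvPolynomial.eval₂Hom (Int.castRingHom A) (fun jk : Fin n × Fin r => x jk.2 jk.1)).comp
    (R n S).subtype

/-- The embedding `φ_L : 𝓞_L ^ r → (𝔸ⁿ)ʳ(K̄)` attached to a numbering `ρ₁, …, ρₙ` of the
`K`-embeddings of `L` in `K̄`. -/
def phi {n r : ℕ} {K L Kbar : Type*} [Field K] [Field L] [Field Kbar] [Algebra K L]
    [Algebra K Kbar] (ρ : Fin n ≃ (L →ₐ[K] Kbar)) (α : Fin r → NumberField.RingOfIntegers L) :
    Pts n r Kbar :=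
  fun k j => ρ j (α k : L)

end Multisymmetric

/-! Read a point of (𝔸ⁿ)ʳ as n rows x_1, …, x_n in r-space. Take T ⊆ Σ₀ with m = ⌊n/2⌋ + 1 elements
and let E = (T + T) ∪ {e_k} (`sumset T`). The hypotheses place (T + T) + E inside Σ, so points in
one fiber of F_Σ have equal moments ∑ x_i^τ for τ in this set. Two things are needed: a nonzero
polynomial P, depending on T alone, such that P(x) ≠ 0 forces the fiber of x to consist of row
permutations of x; and small integers α_k whose conjugates do not annihilate P.

Rigidity. Since |T + T| ≥ 2m - 1 ≥ n, equality of Gram matrices gives an orthogonal Z with y_j^τ =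
∑_i Z_ji x_i^τ for τ in E (`exists_orthogonal_of_moments`). Restricted to T + T, row j writes the
rank one form of y_j as a combination of those of the x_i, which are in general position. A
Kruskal-type argument (`support_of_rank_one`) leaves one nonzero entry in the row, or no zero entry
together with n = 2m - 1. One row with a single nonzero entry forces all rows to have this shape,
and then Z is a signed permutation matrix whose signs are trivial.

For odd n a matrix without zeros must be excluded at a generic point. By elimination
(`exists_resultant`) it suffices to do so over a finite extension of ℚ(x), where the partial
derivatives exist. If |E| ≥ n + r, differentiating the relations yields a contradiction
(`false_of_full_support`). A Freiman-type count (`card_sumset`) shows that this inequality fails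
only for an initial segment of a coordinate axis, handled by Newton's identities, and for T = {0,
e_k, e_l}, handled by plane geometry with five points.

Small integers. A greedy K-basis β of integers satisfies house(β_{n-1}) ≤ house(β_a) house(β_b)
whenever a + b = n - 1, while counting lattice points bounds the product of all the houses by the
square root of the discriminant (`IsGreedy.house_pow_le`). As P is nonzero, it is nonzero at some
combination of the β_l with natural coefficients at most deg P. -/

namespace Multisymmetric

/-! ### Derivations on finite extensions of rational function fields -/

/-- Derivations extend along formally étale algebras. -/
theorem exists_derivation_of_formallyEtale {k A B : Type*} [CommRing k] [CommRing A] [CommRing B]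
    [Algebra k A] [Algebra k B] [Algebra A B] [IsScalarTower k A B] [Algebra.FormallyEtale A B]
    (d : Derivation k A B) :
    ∃ D : Derivation k B B, ∀ a, D (algebraMap A B a) = d a := by
  let e := KaehlerDifferential.tensorKaehlerEquivOfFormallyEtale k A B
  let l : TensorProduct A B (Ω[A⁄k]) →ₗ[B] B :=
    LinearMap.liftBaseChange B d.liftKaehlerDifferential
  let φ : Ω[B⁄k] →ₗ[B] B := l ∘ₗ e.symm.toLinearMap
  refine ⟨φ.compDer (KaehlerDifferential.D k B), fun a => ?_⟩
  have h := KaehlerDifferential.tensorKaehlerEquivOfFormallyEtale_symm_D_algebraMap k A B a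
  simp [φ, e, l, h]

/-- The partial derivatives of a polynomial ring extend to finite extensions of its fraction
field. -/
theorem exists_partial_derivation {X : Type*} [DecidableEq X] {E Ω' : Type*} [Field E] [Field Ω']
    [Algebra (MvPolynomial X ℚ) E] [IsFractionRing (MvPolynomial X ℚ) E] [Algebra E Ω']
    [FiniteDimensional E Ω'] [Algebra (MvPolynomial X ℚ) Ω'] [Algebra ℚ Ω'] [Algebra ℚ E]
    [IsScalarTower (MvPolynomial X ℚ) E Ω'] [IsScalarTower ℚ (MvPolynomial X ℚ) Ω']
    [CharZero E] (a : X) :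
    ∃ D : Derivation ℚ Ω' Ω', ∀ b, D (algebraMap (MvPolynomial X ℚ) Ω' (MvPolynomial.X b)) =
      if b = a then 1 else 0 := by
  have h1 : Algebra.FormallyEtale (MvPolynomial X ℚ) E :=
    Algebra.FormallyEtale.of_isLocalization (nonZeroDivisors (MvPolynomial X ℚ))
  have h2 : Algebra.FormallyEtale E Ω' := Algebra.FormallyEtale.of_isSeparable E Ω'
  have h3 : Algebra.FormallyEtale (MvPolynomial X ℚ) Ω' :=
    Algebra.FormallyEtale.comp (MvPolynomial X ℚ) E Ω'
  obtain ⟨D, hD⟩ := exists_derivation_of_formallyEtale (k := ℚ) (A := MvPolynomial X ℚ) (B := Ω')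
    (MvPolynomial.mkDerivation ℚ (fun b => if b = a then (1 : Ω') else 0))
  exact ⟨D, fun b => by rw [hD, MvPolynomial.mkDerivation_X]⟩

theorem derivation_aeval {k R Ω' : Type*} [CommRing k] [CommRing Ω'] [Algebra k Ω'] [Fintype R]
    (D : Derivation k Ω' Ω') (p : R → Ω') (f : MvPolynomial R k) :
    D (MvPolynomial.aeval p f) =
      ∑ m, MvPolynomial.aeval p (MvPolynomial.pderiv m f) * D (p m) := by
  classical
  induction f using MvPolynomial.induction_on with
  | C a => simp [MvPolynomial.algHom_C]
  | add f g hf hg => simp [hf, hg, add_mul, Finset.sum_add_distrib]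
  | mul_X f i hf =>
    have h : ∀ m, MvPolynomial.aeval p (MvPolynomial.pderiv m (f * MvPolynomial.X i)) * D (p m) =
        p i * (MvPolynomial.aeval p (MvPolynomial.pderiv m f) * D (p m)) +
          if m = i then MvPolynomial.aeval p f * D (p m) else 0 := fun m => by
      rw [Derivation.leibniz, MvPolynomial.pderiv_X, Pi.single_apply]
      by_cases hm : m = i
      · subst hm; simp; ring
      · simp [hm, Ne.symm hm]; ring
    rw [map_mul, MvPolynomial.aeval_X, Derivation.leibniz, hf, Finset.sum_congr rfl fun m _ => h m,
      Finset.sum_add_distrib, Finset.sum_ite_eq' Finset.univ i]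
    simp [Finset.mul_sum, add_comm]

end Multisymmetric

/-! ### Elimination: from the generic point to a resultant -/

namespace Multisymmetric

open MvPolynomial in
/-- Clearing denominators in a certificate of unsolvability over the fraction field. -/
theorem exists_C_mem_of_map_eq_top {A E V : Type*} [CommRing A] [IsDomain A] [Field E] [Algebra A E]
    [IsFractionRing A E] (J : Ideal (MvPolynomial V A))
    (hJ : J.map (MvPolynomial.map (algebraMap A E)) = ⊤) :
    ∃ P : A, P ≠ 0 ∧ (C P : MvPolynomial V A) ∈ J := by
  let _ : Algebra (MvPolynomial V A) (MvPolynomial V E) := algebraMvPolynomial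
  have hloc : IsLocalization ((nonZeroDivisors A).map (C : A →+* MvPolynomial V A))
      (MvPolynomial V E) := MvPolynomial.isLocalization _ _
  have h2 : (algebraMap (MvPolynomial V A) (MvPolynomial V E) 1) ∈
      J.map (algebraMap (MvPolynomial V A) (MvPolynomial V E)) := by
    have : J.map (algebraMap (MvPolynomial V A) (MvPolynomial V E)) = ⊤ := hJ
    rw [this]; trivial
  rw [IsLocalization.algebraMap_mem_map_algebraMap_iff
    ((nonZeroDivisors A).map (C : A →+* MvPolynomial V A))] at h2
  obtain ⟨_, ⟨P, hP, rfl⟩, hm⟩ := h2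
  exact ⟨P, nonZeroDivisors.ne_zero hP, by simpa using hm⟩

open MvPolynomial in
/-- A proper ideal over a field has a zero in a finite extension. -/
theorem exists_zero_of_ne_top {E V : Type} [Field E] [Finite V] (J : Ideal (MvPolynomial V E))
    (hJ : J ≠ ⊤) : ∃ (Ω : Type) (_ : Field Ω) (_ : Algebra E Ω) (v : V → Ω),
      FiniteDimensional E Ω ∧ ∀ f ∈ J, aeval v f = 0 := by
  obtain ⟨M, hM, hJM⟩ := Ideal.exists_le_maximal _ hJ
  let _ : Field (MvPolynomial V E ⧸ M) := Ideal.Quotient.field M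
  have hfin : Module.Finite E (MvPolynomial V E ⧸ M) := finite_of_finite_type_of_isJacobsonRing E _
  refine ⟨MvPolynomial V E ⧸ M, inferInstance, inferInstance,
    fun b => Ideal.Quotient.mkₐ E M (MvPolynomial.X b), hfin, fun f hf => ?_⟩
  have : aeval (fun b => Ideal.Quotient.mkₐ E M (MvPolynomial.X b)) f =
      Ideal.Quotient.mkₐ E M f := by
    rw [← MvPolynomial.comp_aeval_apply, MvPolynomial.aeval_X_left_apply]
  rw [this]
  exact Ideal.Quotient.eq_zero_iff_mem.2 (hJM hf)

open MvPolynomial in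
/-- A system that is consistent over `ℚ(X)` has a solution in a field in which the elements of `X`
are algebraically independent and carry partial derivations. -/
theorem exists_generic_zero {X V : Type} [Finite V] [DecidableEq X] (E : Type) [Field E]
    [Algebra (MvPolynomial X ℚ) E] [IsFractionRing (MvPolynomial X ℚ) E]
    (J : Ideal (MvPolynomial V (MvPolynomial X ℚ)))
    (hJ : J.map (MvPolynomial.map (algebraMap (MvPolynomial X ℚ) E)) ≠ ⊤) :
    ∃ (Ω : Type) (_ : Field Ω) (_ : Algebra ℚ Ω) (p : X → Ω) (D : X → Derivation ℚ Ω Ω) (v : V → Ω),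
      Function.Injective (aeval p : MvPolynomial X ℚ →ₐ[ℚ] Ω) ∧
      (∀ a b, D a (p b) = if b = a then 1 else 0) ∧
      ∀ f ∈ J, eval₂ (aeval p : MvPolynomial X ℚ →ₐ[ℚ] Ω).toRingHom v f = 0 := by
  obtain ⟨Ω, _, _, v, hfin, hv⟩ := exists_zero_of_ne_top _ hJ
  let _ : Algebra (MvPolynomial X ℚ) Ω :=
    ((algebraMap E Ω).comp (algebraMap (MvPolynomial X ℚ) E)).toAlgebra
  have : IsScalarTower (MvPolynomial X ℚ) E Ω := IsScalarTower.of_algebraMap_eq fun _ => rfl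
  let _ : Algebra ℚ Ω :=
    ((algebraMap (MvPolynomial X ℚ) Ω).comp (algebraMap ℚ (MvPolynomial X ℚ))).toAlgebra
  have : IsScalarTower ℚ (MvPolynomial X ℚ) Ω := IsScalarTower.of_algebraMap_eq fun _ => rfl
  have : CharZero E := charZero_of_injective_algebraMap (IsFractionRing.injective (MvPolynomial X ℚ) E)
  have hinj : Function.Injective (algebraMap (MvPolynomial X ℚ) Ω) :=
    (algebraMap E Ω).injective.comp (IsFractionRing.injective (MvPolynomial X ℚ) E)
  have hae : (aeval (fun b : X => algebraMap (MvPolynomial X ℚ) Ω (MvPolynomial.X b)) :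
      MvPolynomial X ℚ →ₐ[ℚ] Ω) = IsScalarTower.toAlgHom ℚ (MvPolynomial X ℚ) Ω := by
    ext b; simp
  choose D hD using fun a : X => exists_partial_derivation (E := E) (Ω' := Ω) a
  refine ⟨Ω, _, _, fun b => algebraMap (MvPolynomial X ℚ) Ω (MvPolynomial.X b), D, v, ?_, hD,
    fun f hf => ?_⟩
  · rw [hae]; exact hinj
  · rw [hae, ← hv _ (Ideal.mem_map_of_mem _ hf), aeval_def, eval₂_map]
    rfl

open MvPolynomial in
/-- If a system of polynomial equations with coefficients in `ℚ[X]` has no solution over the finite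
extensions of `ℚ(X)`, then some nonzero element of `ℚ[X]` vanishes wherever a specialization
of the system is solvable. -/
theorem exists_resultant {X V : Type} [Finite V] [DecidableEq X]
    (sys : Set (MvPolynomial V (MvPolynomial X ℚ)))
    (h : ∀ (Ω : Type) [Field Ω] [Algebra ℚ Ω] (p : X → Ω),
      Function.Injective (aeval p : MvPolynomial X ℚ →ₐ[ℚ] Ω) →
      ∀ D : X → Derivation ℚ Ω Ω, (∀ a b, D a (p b) = if b = a then 1 else 0) →
      ∀ v : V → Ω, ¬ ∀ f ∈ sys, eval₂ (aeval p : MvPolynomial X ℚ →ₐ[ℚ] Ω).toRingHom v f = 0) :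
    ∃ P : MvPolynomial X ℚ, P ≠ 0 ∧ ∀ {F : Type*} [Field F] [Algebra ℚ F] (x : X → F) (v : V → F),
      (∀ f ∈ sys, eval₂ (aeval x : MvPolynomial X ℚ →ₐ[ℚ] F).toRingHom v f = 0) →
      aeval x P = 0 := by
  by_cases hJ : (Ideal.span sys).map
      (MvPolynomial.map (algebraMap (MvPolynomial X ℚ) (FractionRing (MvPolynomial X ℚ)))) = ⊤
  · obtain ⟨P, hP, hm⟩ := exists_C_mem_of_map_eq_top _ hJ
    refine ⟨P, hP, fun {F} _ _ x v hv => ?_⟩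
    have hle : Ideal.span sys ≤
        RingHom.ker (eval₂Hom (aeval x : MvPolynomial X ℚ →ₐ[ℚ] F).toRingHom v) :=
      Ideal.span_le.2 fun f hf => by simpa using hv f hf
    have := hle hm
    simpa using this
  · obtain ⟨Ω, _, _, p, D, v, hp, hD, hv⟩ := exists_generic_zero _ _ hJ
    exact absurd (fun f hf => hv f (Ideal.subset_span hf)) (h Ω p hp D hD v)

end Multisymmetric

/-! ### Monomials and generic linear independence -/

namespace Multisymmetric

/-- The value at `p` of the monomial with exponent `τ`. -/
def mon {r : ℕ} {A : Type*} [CommSemiring A] (τ : Fin r → ℕ) (p : Fin r → A) : A :=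
  ∏ k, p k ^ τ k

section mon

variable {r : ℕ} {A : Type*} [CommSemiring A]

theorem mon_add (σ τ : Fin r → ℕ) (p : Fin r → A) : mon (σ + τ) p = mon σ p * mon τ p := by
  simp [mon, pow_add, Finset.prod_mul_distrib]

@[simp] theorem mon_zero (p : Fin r → A) : mon 0 p = 1 := by simp [mon]

@[simp] theorem mon_single (k : Fin r) (p : Fin r → A) : mon (Pi.single k 1) p = p k := by
  simp [mon, Pi.single_apply, Finset.prod_ite_eq']

@[simp] theorem mon_one (τ : Fin r → ℕ) : mon τ (fun _ => (1 : A)) = 1 := by simp [mon]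

theorem mon_mul (τ : Fin r → ℕ) (p q : Fin r → A) :
    mon τ (fun k => p k * q k) = mon τ p * mon τ q := by
  simp [mon, mul_pow, Finset.prod_mul_distrib]

theorem mon_const_mul (τ : Fin r → ℕ) (c : A) (p : Fin r → A) :
    mon τ (fun k => c * p k) = c ^ (∑ k, τ k) * mon τ p := by
  rw [mon_mul, mon, Finset.prod_pow_eq_pow_sum]

theorem map_mon {B G : Type*} [CommSemiring B] [FunLike G A B] [MonoidHomClass G A B] (φ : G)
    (τ : Fin r → ℕ) (p : Fin r → A) : φ (mon τ p) = mon τ (fun k => φ (p k)) := by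
  simp [mon]

end mon

/-- The monomial with exponent `τ` as a polynomial. -/
noncomputable def monPoly {r : ℕ} (τ : Fin r → ℕ) : MvPolynomial (Fin r) ℚ :=
  mon τ MvPolynomial.X

theorem monPoly_eq {r : ℕ} (τ : Fin r → ℕ) :
    monPoly τ = MvPolynomial.monomial (Finsupp.equivFunOnFinite.symm τ) 1 := by
  rw [MvPolynomial.monomial_eq, Finsupp.prod_fintype]
  · simp [monPoly, mon]
  · simp

@[simp] theorem aeval_monPoly {r : ℕ} {A : Type*} [CommRing A] [Algebra ℚ A] (τ : Fin r → ℕ)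
    (p : Fin r → A) : MvPolynomial.aeval p (monPoly τ) = mon τ p := by
  simp [monPoly, map_mon]

theorem pderiv_monPoly {r : ℕ} (τ : Fin r → ℕ) (k : Fin r) :
    MvPolynomial.pderiv k (monPoly τ) = MvPolynomial.C (τ k : ℚ) * monPoly (τ - Pi.single k 1) := by
  rw [monPoly_eq, monPoly_eq, MvPolynomial.pderiv_monomial, MvPolynomial.C_mul_monomial]
  have h : Finsupp.equivFunOnFinite.symm τ - Finsupp.single k 1 =
      Finsupp.equivFunOnFinite.symm (τ - Pi.single k 1) := by
    refine Finsupp.ext fun j => ?_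
    simp [Finsupp.single_apply, Pi.single_apply, eq_comm]
  rw [h]
  simp

/-- The derivative in direction `k` at `p` of the monomial with exponent `τ`. -/
noncomputable def dmon {r : ℕ} {A : Type*} [CommRing A] (τ : Fin r → ℕ) (k : Fin r)
    (p : Fin r → A) : A :=
  (τ k : A) * mon (τ - Pi.single k 1) p

theorem aeval_pderiv_monPoly {r : ℕ} {A : Type*} [CommRing A] [Algebra ℚ A] (τ : Fin r → ℕ)
    (k : Fin r) (p : Fin r → A) :
    MvPolynomial.aeval p (MvPolynomial.pderiv k (monPoly τ)) = dmon τ k p := by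
  simp [pderiv_monPoly, dmon]

theorem derivation_mon {r : ℕ} {Ω : Type*} [CommRing Ω] [Algebra ℚ Ω] (D : Derivation ℚ Ω Ω)
    (τ : Fin r → ℕ) (p : Fin r → Ω) : D (mon τ p) = ∑ m, dmon τ m p * D (p m) := by
  rw [← aeval_monPoly, derivation_aeval]
  simp [aeval_pderiv_monPoly]

/-- A generic monomial vector avoids a given proper subspace. -/
theorem exists_mon_notMem {r : ℕ} {ι : Type*} [Fintype ι] {e : ι → Fin r → ℕ}
    (he : Function.Injective e) {V : Submodule ℚ (ι → ℚ)} (hV : V ≠ ⊤) :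
    ∃ p : Fin r → ℚ, (fun i => mon (e i) p) ∉ V := by
  classical
  obtain ⟨f, hf, hVf⟩ := Submodule.exists_le_ker_of_lt_top V (lt_top_iff_ne_top.2 hV)
  by_contra! hall
  apply hf
  have hfv : ∀ v : ι → ℚ, f v = ∑ i, v i * f (Pi.single i 1) := fun v => by
    conv_lhs => rw [← Finset.univ_sum_single v, map_sum]
    refine Finset.sum_congr rfl fun i _ => ?_
    rw [← smul_eq_mul, ← map_smul]
    congr 1
    ext j; simp [Pi.single_apply]
  -- A hyperplane containing all the monomial vectors is a polynomial vanishing on ℚʳ, hence zero;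
  -- injectivity of `e` keeps its coefficients separate.
  have hg : ∑ i, MvPolynomial.monomial (Finsupp.equivFunOnFinite.symm (e i))
      (f (Pi.single i 1)) = 0 := by
    apply MvPolynomial.funext
    intro p
    have h1 : f (fun i => mon (e i) p) = 0 := hVf (hall p)
    rw [hfv] at h1
    rw [map_sum, map_zero, ← h1]
    refine Finset.sum_congr rfl fun i _ => ?_
    rw [MvPolynomial.eval_monomial, Finsupp.prod_fintype _ _ (by simp)]
    simp [mon, mul_comm]
  refine LinearMap.ext fun v => ?_
  rw [hfv, LinearMap.zero_apply]
  refine Finset.sum_eq_zero fun i _ => ?_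
  have h2 := congrArg (MvPolynomial.coeff (Finsupp.equivFunOnFinite.symm (e i))) hg
  rw [MvPolynomial.coeff_sum, Finset.sum_eq_single i] at h2
  · simp at h2; simp [h2]
  · intro j _ hj
    rw [MvPolynomial.coeff_monomial, if_neg]
    intro h; exact hj (he (Finsupp.equivFunOnFinite.symm.injective h))
  · simp

/-- A linearly independent family of vectors can be extended by generic monomial vectors. -/
theorem exists_linearIndependent_mon {r : ℕ} {ι : Type*} [Fintype ι] {e : ι → Fin r → ℕ}
    (he : Function.Injective e) {s : Type*} [Fintype s] {v : s → ι → ℚ}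
    (hv : LinearIndependent ℚ v) (I : Type*) [Finite I] :
    Nat.card s + Nat.card I ≤ Nat.card ι →
    ∃ p : I → Fin r → ℚ, LinearIndependent ℚ (Sum.elim v fun i j => mon (e j) (p i)) := by
  induction I using Finite.induction_empty_option with
  | @of_equiv I I' f h =>
    intro hc
    obtain ⟨p, hp⟩ := h (by rwa [Nat.card_congr f])
    refine ⟨p ∘ f.symm, ?_⟩
    have := hp.comp (Equiv.sumCongr (Equiv.refl s) f.symm) (Equiv.injective _)
    convert this using 1
    ext x; cases x <;> rfl
  | h_empty =>
    intro _
    refine ⟨fun i => i.elim, ?_⟩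
    have := hv.comp (Equiv.sumEmpty s PEmpty) (Equiv.injective _)
    convert this using 1
    ext x; rcases x with x | x
    · rfl
    · exact x.elim
  | @h_option I _ h =>
    intro hc
    rw [Finite.card_option] at hc
    obtain ⟨p, hp⟩ := h (by omega)
    obtain ⟨q, hq⟩ := exists_mon_notMem he
      (V := Submodule.span ℚ (Set.range (Sum.elim v fun i j => mon (e j) (p i)))) (by
        intro htop
        have : Fintype I := Fintype.ofFinite I
        have h1' : Module.finrank ℚ (Submodule.span ℚ (Set.range
            (Sum.elim v fun i j => mon (e j) (p i)))) ≤ Fintype.card (s ⊕ I) :=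
          finrank_range_le_card _
        rw [Fintype.card_sum] at h1'
        rw [htop, finrank_top, Module.finrank_fintype_fun_eq_card] at h1'
        rw [Nat.card_eq_fintype_card, Nat.card_eq_fintype_card, Nat.card_eq_fintype_card] at hc
        omega)
    refine ⟨fun o => o.elim q p, ?_⟩
    have h2 := (linearIndependent_option' (v := Sum.elim v fun i j => mon (e j) (p i))
      (x := fun i => mon (e i) q)).2 ⟨hp, hq⟩
    let g : s ⊕ Option I → Option (s ⊕ I) := fun x => match x with
      | Sum.inl a => some (Sum.inl a)
      | Sum.inr none => none
      | Sum.inr (some i) => some (Sum.inr i)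
    have hg : Function.Injective g := by
      rintro (a | _ | a) (b | _ | b) h <;> simp_all [g]
    have h3 := h2.comp g hg
    have h4 : (Sum.elim v fun i j => mon (e j) ((fun o : Option I => o.elim q p) i)) =
        (fun o : Option (s ⊕ I) => Option.casesOn' o (fun i => mon (e i) q)
          (Sum.elim v fun i j => mon (e j) (p i))) ∘ g := by
      ext x; rcases x with x | _ | x <;> rfl
    rw [h4]
    exact h3

end Multisymmetric

/-! ### Determinants that do not vanish generically -/

namespace Multisymmetric

open MvPolynomial

/-- The `i`-th row of the generic point of `(𝔸ʳ)ⁿ`. -/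
noncomputable def genericRow {n r : ℕ} (i : Fin n) : Fin r → MvPolynomial (Fin n × Fin r) ℚ :=
  fun k => X (i, k)

/-- The matrix of values of the monomials `e` at the generic rows `J`. -/
noncomputable def genericMatrix {n r : ℕ} {ι : Type*} (e : ι → Fin r → ℕ) (J : ι → Fin n) :
    Matrix ι ι (MvPolynomial (Fin n × Fin r) ℚ) :=
  Matrix.of fun a b => mon (e b) (genericRow (J a))

theorem aeval_det_genericMatrix {n r : ℕ} {ι : Type*} [Fintype ι] [DecidableEq ι]
    (e : ι → Fin r → ℕ) (J : ι → Fin n) {A : Type*} [CommRing A] [Algebra ℚ A]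
    (x : Fin n → Fin r → A) :
    aeval (fun ik : Fin n × Fin r => x ik.1 ik.2) (genericMatrix e J).det =
      (Matrix.of fun a b => mon (e b) (x (J a))).det := by
  rw [AlgHom.map_det]
  congr 1
  ext a b
  simp [genericMatrix, genericRow, map_mon]

theorem det_genericMatrix_ne_zero {n r : ℕ} {ι : Type*} [Fintype ι] [DecidableEq ι]
    {e : ι → Fin r → ℕ} (he : Function.Injective e) {J : ι → Fin n} (hJ : Function.Injective J) :
    (genericMatrix e J).det ≠ 0 := by
  obtain ⟨p, hp⟩ := exists_linearIndependent_mon he (s := PEmpty.{1}) (v := fun i => i.elim)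
    (linearIndependent_empty_type) ι (by simp)
  have h1 : LinearIndependent ℚ (fun a b => mon (e b) (p a)) :=
    hp.comp Sum.inr Sum.inr_injective
  have h2 : IsUnit (Matrix.of fun a b => mon (e b) (p a)) :=
    Matrix.linearIndependent_rows_iff_isUnit.1 h1
  intro h0
  have h3 := aeval_det_genericMatrix e J (A := ℚ) (Function.extend J p 0)
  rw [h0, map_zero] at h3
  simp only [hJ.extend_apply] at h3
  rw [Matrix.isUnit_iff_isUnit_det, ← h3] at h2
  exact not_isUnit_zero h2

/-- The matrix of the functionals `h ↦ h(x_i)` and `h ↦ ∂ₖ h(x_{i₀})` on the span of the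
monomials `e`. -/
noncomputable def jetMatrix {n r : ℕ} {A : Type*} [CommRing A] (e : Fin n ⊕ Fin r → Fin r → ℕ)
    (i₀ : Fin n) (x : Fin n → Fin r → A) : Matrix (Fin n ⊕ Fin r) (Fin n ⊕ Fin r) A :=
  Matrix.of fun a c => Sum.elim (fun i => mon (e c) (x i)) (fun k => dmon (e c) k (x i₀)) a

theorem aeval_det_jetMatrix {n r : ℕ} (e : Fin n ⊕ Fin r → Fin r → ℕ) (i₀ : Fin n)
    {A : Type*} [CommRing A] [Algebra ℚ A] (x : Fin n → Fin r → A) :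
    aeval (fun ik : Fin n × Fin r => x ik.1 ik.2) (jetMatrix e i₀ genericRow).det =
      (jetMatrix e i₀ x).det := by
  rw [AlgHom.map_det]
  congr 1
  ext a b
  rcases a with i | k <;> simp [jetMatrix, genericRow, map_mon, dmon]

theorem mon_sum_ne_one {r : ℕ} {τ : Fin r → ℕ} (h : ∀ k, τ ≠ Pi.single k 1) :
    ∑ k, τ k ≠ 1 := by
  intro h1
  have h2 : ∃ k, τ k ≠ 0 := by
    by_contra! h0
    simp [h0] at h1
  obtain ⟨k, hk⟩ := h2
  refine h k (funext fun j => ?_)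
  have h3 := Finset.add_sum_erase Finset.univ τ (Finset.mem_univ k)
  have h4 : ∑ i ∈ Finset.univ.erase k, τ i = 0 := by omega
  rw [Finset.sum_eq_zero_iff] at h4
  by_cases hj : j = k
  · subst hj; simp; omega
  · simp [hj, h4 j (by simp [hj])]

/-- It suffices to specialize. At x_{i₀} = (1, …, 1) the value functional becomes the all-ones
vector and the k-th derivative becomes the vector of k-th exponents. The columns at the e_k force
every derivative coefficient in a linear relation to be minus that of the value; a further exponent,
of degree different from 1, kills the latter. The remaining rows are added as generic monomial
vectors. -/
theorem det_jetMatrix_ne_zero {n r : ℕ} {e : Fin n ⊕ Fin r → Fin r → ℕ}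
    (he : Function.Injective e) (hk : ∀ k, e (Sum.inr k) = Pi.single k 1) (i₀ : Fin n) :
    (jetMatrix e i₀ genericRow).det ≠ 0 := by
  let v : Option (Fin r) → Fin n ⊕ Fin r → ℚ := fun o c => o.elim 1 fun k => (e c k : ℚ)
  have hv : LinearIndependent ℚ v := by
    rw [Fintype.linearIndependent_iff]
    intro g hg
    have h1 : ∀ c, g none + ∑ k, g (some k) * (e c k : ℚ) = 0 := fun c => by
      have := congrFun hg c
      simpa [v, Fintype.sum_option] using this
    have h2 : ∀ k, g (some k) = - g none := fun k => by
      have := h1 (Sum.inr k)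
      rw [hk] at this
      simp [Pi.single_apply] at this
      linarith
    have h3 : g none = 0 := by
      have := h1 (Sum.inl i₀)
      simp only [h2] at this
      rw [← Finset.mul_sum] at this
      have h5 : g none * (1 - ((∑ k, e (Sum.inl i₀) k : ℕ) : ℚ)) = 0 := by
        push_cast; linarith
      rcases mul_eq_zero.1 h5 with h | h
      · exact h
      · exfalso
        refine mon_sum_ne_one (τ := e (Sum.inl i₀)) (fun k hkk => ?_) ?_
        · rw [← hk k] at hkk
          exact absurd (he hkk) (by simp)
        · have : ((∑ k, e (Sum.inl i₀) k : ℕ) : ℚ) = 1 := by linarith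
          exact_mod_cast this
    rintro (_ | k)
    · exact h3
    · rw [h2, h3, neg_zero]
  have hcard : Fintype.card {i : Fin n // i ≠ i₀} = n - 1 := by
    simp
  have hn : 0 < n := i₀.pos
  obtain ⟨p, hp⟩ := exists_linearIndependent_mon he hv {i : Fin n // i ≠ i₀} (by
    rw [Nat.card_eq_fintype_card, Nat.card_eq_fintype_card, Nat.card_eq_fintype_card, hcard]
    simp
    omega)
  let x : Fin n → Fin r → ℚ := fun i => if h : i = i₀ then fun _ => 1 else p ⟨i, h⟩
  let g : Fin n ⊕ Fin r → Option (Fin r) ⊕ {i : Fin n // i ≠ i₀} := fun a => match a with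
    | Sum.inl i => if h : i = i₀ then Sum.inl none else Sum.inr ⟨i, h⟩
    | Sum.inr k => Sum.inl (some k)
  have hg : Function.Injective g := by
    rintro (i | k) (i' | k') h
    · simp only [g] at h
      split_ifs at h; all_goals simp_all
    · simp only [g] at h
      split_ifs at h; all_goals simp_all
    · simp only [g] at h
      split_ifs at h; all_goals simp_all
    · simpa [g] using h
  have h3 := hp.comp g hg
  have h4 : (fun a => jetMatrix e i₀ x a) =
      (Sum.elim v fun i j => mon (e j) (p i)) ∘ g := by
    funext a
    ext c
    rcases a with i | k
    · by_cases h : i = i₀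
      · subst h; simp [jetMatrix, g, x, v]
      · simp [jetMatrix, g, x, v, h]
    · simp [jetMatrix, g, x, v, dmon]
  rw [← h4] at h3
  have h2 : IsUnit (jetMatrix e i₀ x) := Matrix.linearIndependent_rows_iff_isUnit.1 h3
  intro h0
  have h5 := aeval_det_jetMatrix e i₀ (A := ℚ) x
  rw [h0, map_zero] at h5
  rw [Matrix.isUnit_iff_isUnit_det, ← h5] at h2
  exact not_isUnit_zero h2

end Multisymmetric

/-! ### Mixing matrices and rank one forms -/

namespace Multisymmetric

open Matrix

/-- Two families with equal moments differ by an orthogonal matrix. -/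
theorem exists_orthogonal_of_moments {n r : ℕ} {F : Type*} [Field F]
    {x y : Fin n → Fin r → F} {W W' : Set (Fin r → ℕ)}
    (hm : ∀ τ ∈ W, ∀ τ' ∈ W', ∑ i, mon (τ + τ') (x i) = ∑ i, mon (τ + τ') (y i))
    {B : Fin n → Fin r → ℕ} (hB : ∀ a, B a ∈ W) (hB' : ∀ a, B a ∈ W')
    (hdet : (Matrix.of fun i b => mon (B b) (x i)).det ≠ 0) :
    ∃ Z : Matrix (Fin n) (Fin n) F, Z * Zᵀ = 1 ∧
      ∀ τ ∈ W', ∀ j, mon τ (y j) = ∑ i, Z j i * mon τ (x i) := by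
  set X : Matrix (Fin n) (Fin n) F := Matrix.of fun i b => mon (B b) (x i) with hX
  set Y : Matrix (Fin n) (Fin n) F := Matrix.of fun i b => mon (B b) (y i) with hY
  have hXu : IsUnit X.det := isUnit_iff_ne_zero.2 hdet
  have hgram : Xᵀ * X = Yᵀ * Y := by
    ext a b
    have := hm _ (hB a) _ (hB' b)
    simpa [hX, hY, Matrix.mul_apply, mon_add] using this
  -- Equal Gram matrices make Y X⁻¹ orthogonal.
  have hZ : (Y * X⁻¹)ᵀ * (Y * X⁻¹) = 1 := by
    rw [transpose_mul, Matrix.mul_assoc, ← Matrix.mul_assoc Yᵀ, ← hgram, Matrix.mul_assoc,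
      Matrix.mul_nonsing_inv _ hXu, Matrix.mul_one, ← transpose_mul,
      Matrix.mul_nonsing_inv _ hXu, transpose_one]
  refine ⟨Y * X⁻¹, mul_eq_one_comm.1 hZ, fun τ hτ j => ?_⟩
  set u : Fin n → F := fun i => mon τ (x i) with hu
  set w : Fin n → F := fun i => mon τ (y i) with hw
  -- Pairing a further monomial τ ∈ W' with the basis monomials, which lie in W, uses only moments
  -- in W + W'. This determines its values at the y_j.
  have h1 : Xᵀ *ᵥ u = Yᵀ *ᵥ w := by
    ext a
    have := hm _ (hB a) _ hτ
    simpa [hX, hY, hu, hw, Matrix.mulVec, dotProduct, mon_add] using this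
  have h2 : Y = (Y * X⁻¹) * X := by
    rw [Matrix.mul_assoc, Matrix.nonsing_inv_mul _ hXu, Matrix.mul_one]
  have h3 : Xᵀ *ᵥ u = Xᵀ *ᵥ ((Y * X⁻¹)ᵀ *ᵥ w) := by
    rw [h1, mulVec_mulVec, ← transpose_mul, ← h2]
  have hXt : IsUnit Xᵀ := by
    rw [Matrix.isUnit_iff_isUnit_det, det_transpose]; exact hXu
  have h4 : u = (Y * X⁻¹)ᵀ *ᵥ w := Matrix.mulVec_injective_of_isUnit hXt h3
  have h5 : w = (Y * X⁻¹) *ᵥ u := by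
    rw [h4, mulVec_mulVec, mul_eq_one_comm.1 hZ, one_mulVec]
  exact congrFun h5 j

/-- If `Z` expresses the monomials of `y j` through those of the `x i`, and `y j` agrees with
`x i₀` on a basis of monomials, then the `j`-th row of `Z` is supported at `i₀`. -/
theorem row_eq_single {n r : ℕ} {F : Type*} [Field F] {x : Fin n → Fin r → F}
    {B : Fin n → Fin r → ℕ} (hdet : (Matrix.of fun i b => mon (B b) (x i)).det ≠ 0)
    {z : Fin n → F} {i₀ : Fin n}
    (h : ∀ b, mon (B b) (x i₀) = ∑ i, z i * mon (B b) (x i)) : z = Pi.single i₀ 1 := by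
  have hu : IsUnit (Matrix.of fun i b => mon (B b) (x i)) := by
    rw [Matrix.isUnit_iff_isUnit_det]; exact isUnit_iff_ne_zero.2 hdet
  apply Matrix.vecMul_injective_of_isUnit hu
  ext b
  simp [Matrix.vecMul, dotProduct, ← h b, Pi.single_apply]

/-- A combination of rank one forms in general position that is again of rank one has at most
one term, or more than `2 m - 2`. -/
theorem support_of_rank_one {n : ℕ} {F τ : Type*} [Field F] [Fintype τ] [DecidableEq τ]
    {P : Fin n → τ → F} (hmn : Fintype.card τ ≤ n)
    (hP : ∀ J : τ → Fin n, Function.Injective J → (Matrix.of fun a b => P (J a) b).det ≠ 0)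
    {z : Fin n → F} {Q : τ → F} (hz : ∀ a b, ∑ i, z i * (P i a * P i b) = Q a * Q b)
    (hn : n + 1 ≤ 2 * Fintype.card τ) {i₀ i₁ i₂ : Fin n} (h01 : i₀ ≠ i₁)
    (hz0 : z i₀ ≠ 0) (hz1 : z i₁ ≠ 0) : (z i₂ ≠ 0) ∧ n + 1 = 2 * Fintype.card τ := by
  classical
  set m := Fintype.card τ with hm
  -- functionals with prescribed values
  have key : ∀ s : Finset (Fin n), s.card ≤ m → ∀ c : Fin n → F, ∃ w : τ → F, ∀ i ∈ s,
      w ⬝ᵥ P i = c i := by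
    intro s hs c
    obtain ⟨t, hst, ht⟩ := Finset.exists_superset_card_eq hs (by simpa using hmn)
    have e : τ ≃ t := Fintype.equivOfCardEq (by simp [ht, hm])
    have hdet := hP (fun a => (e a : Fin n)) (Subtype.val_injective.comp e.injective)
    have hu : IsUnit (Matrix.of fun a b => P (e a : Fin n) b) := by
      rw [Matrix.isUnit_iff_isUnit_det]; exact isUnit_iff_ne_zero.2 hdet
    obtain ⟨w, hw⟩ := (Matrix.mulVec_surjective_iff_isUnit.2 hu) (fun a => c (e a))
    refine ⟨w, fun i hi => ?_⟩
    have := congrFun hw (e.symm ⟨i, hst hi⟩)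
    simp only [Matrix.mulVec, Matrix.of_apply, Equiv.apply_symm_apply] at this
    rw [dotProduct_comm]
    exact this
  have bil : ∀ w w' : τ → F, ∑ i, z i * ((w ⬝ᵥ P i) * (w' ⬝ᵥ P i)) = (w ⬝ᵥ Q) * (w' ⬝ᵥ Q) := by
    intro w w'
    have h1 : ∀ V : τ → F, (w ⬝ᵥ V) * (w' ⬝ᵥ V) = ∑ a, ∑ b, w a * w' b * (V a * V b) := by
      intro V
      rw [dotProduct, dotProduct, Finset.sum_mul_sum]
      exact Finset.sum_congr rfl fun a _ => Finset.sum_congr rfl fun b _ => by ring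
    simp only [h1, Finset.mul_sum]
    rw [Finset.sum_comm]
    refine Finset.sum_congr rfl fun a _ => ?_
    rw [Finset.sum_comm]
    refine Finset.sum_congr rfl fun b _ => ?_
    rw [← hz, Finset.mul_sum]
    exact Finset.sum_congr rfl fun i _ => by ring
  set J : Finset (Fin n) := (Finset.univ.filter fun i => z i ≠ 0) \ {i₀, i₁} with hJ
  have hJ0 : i₀ ∉ J := by simp [hJ]
  have hJ1 : i₁ ∉ J := by simp [hJ]
  by_cases hc : J.card ≤ 2 * m - 4
  · exfalso
    have hm2 : 2 ≤ m := by
      have : 1 < n := by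
        have h1 := i₀.2; have h2 := i₁.2
        by_contra hlt
        exact h01 (Fin.ext (by omega))
      omega
    -- The rest of the support splits into two halves of size at most m - 2. Functionals are
    -- prescribed at i₀, i₁ and zero on one half: w, u vanish on `A` and w', u' on `J \ A`. In each
    -- product of the two kinds only i₀ and i₁ can contribute.
    obtain ⟨A, hAJ, hA⟩ := Finset.exists_subset_card_eq
      (s := J) (n := min (m - 2) J.card) (min_le_right _ _)
    have hAc : A.card ≤ m - 2 := by omega
    have hBc : (J \ A).card ≤ m - 2 := by rw [Finset.card_sdiff_of_subset hAJ]; omega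
    have ins : ∀ S : Finset (Fin n), S.card ≤ m - 2 → (insert i₀ (insert i₁ S)).card ≤ m := by
      intro S hS
      have h1 := Finset.card_insert_le i₀ (insert i₁ S)
      have h2 := Finset.card_insert_le i₁ S
      omega
    obtain ⟨w, hw⟩ := key _ (ins A hAc) (Pi.single i₀ 1)
    obtain ⟨w', hw'⟩ := key _ (ins _ hBc) (Pi.single i₀ 1)
    obtain ⟨u, hu⟩ := key _ (ins A hAc) (Pi.single i₁ 1)
    obtain ⟨u', hu'⟩ := key _ (ins _ hBc) (Pi.single i₁ 1)
    have hcases : ∀ i, z i = 0 ∨ i = i₀ ∨ i = i₁ ∨ (i ∈ A ∧ i ≠ i₀ ∧ i ≠ i₁) ∨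
        (i ∈ J \ A ∧ i ≠ i₀ ∧ i ≠ i₁) := by
      intro i
      by_cases h1 : z i = 0
      · simp [h1]
      by_cases h2 : i = i₀
      · simp [h2]
      by_cases h3 : i = i₁
      · simp [h3]
      have h4 : i ∈ J := by simp [hJ, h1, h2, h3]
      by_cases h5 : i ∈ A
      · simp [h5, h2, h3]
      · simp [h4, h5, h2, h3]
    have val : ∀ a b : Fin n, (a = i₀ ∨ a = i₁) → (b = i₀ ∨ b = i₁) → ∀ w w' : τ → F,
        (∀ i ∈ insert i₀ (insert i₁ A), w ⬝ᵥ P i = (Pi.single a 1 : Fin n → F) i) →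
        (∀ i ∈ insert i₀ (insert i₁ (J \ A)), w' ⬝ᵥ P i = (Pi.single b 1 : Fin n → F) i) →
        (w ⬝ᵥ Q) * (w' ⬝ᵥ Q) = if a = b then z a else 0 := by
      intro a b ha hb w w' hw hw'
      rw [← bil]
      have : ∀ i, z i * ((w ⬝ᵥ P i) * (w' ⬝ᵥ P i)) =
          if i = a then (if a = b then z a else 0) else 0 := by
        intro i
        have both : w ⬝ᵥ P i = (Pi.single a 1 : Fin n → F) i →
            w' ⬝ᵥ P i = (Pi.single b 1 : Fin n → F) i → z i * ((w ⬝ᵥ P i) * (w' ⬝ᵥ P i)) =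
              if i = a then (if a = b then z a else 0) else 0 := by
          intro h h'
          rw [h, h', Pi.single_apply, Pi.single_apply]
          by_cases h1 : i = a
          · by_cases h2 : i = b
            · rw [if_pos h1, if_pos h2, if_pos h1, if_pos (h1.symm.trans h2), h1]; ring
            · rw [if_pos h1, if_neg h2, if_pos h1, if_neg (fun h => h2 (h1.trans h))]; ring
          · rw [if_neg h1, if_neg h1]; ring
        rcases hcases i with h | h | h | ⟨h, h0, h1⟩ | ⟨h, h0, h1⟩
        · rw [h, zero_mul]
          split_ifs with h1 h2
          · rw [← h1, h]
          · rfl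
          · rfl
        · exact both (hw i (by simp [h])) (hw' i (by simp [h]))
        · exact both (hw i (by simp [h])) (hw' i (by simp [h]))
        · have hia : i ≠ a := by rcases ha with rfl | rfl <;> assumption
          rw [hw i (by simp [h])]
          simp [hia]
        · have hib : i ≠ b := by rcases hb with rfl | rfl <;> assumption
          have hia : i ≠ a := by rcases ha with rfl | rfl <;> assumption
          rw [hw' i (Finset.mem_insert_of_mem (Finset.mem_insert_of_mem h))]
          simp [hib, hia]
      rw [Finset.sum_congr rfl fun i _ => this i]
      simp
    have e1 := val i₀ i₀ (Or.inl rfl) (Or.inl rfl) w w' hw hw'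
    have e2 := val i₁ i₁ (Or.inr rfl) (Or.inr rfl) u u' hu hu'
    have e3 := val i₀ i₁ (Or.inl rfl) (Or.inr rfl) w u' hw hu'
    rw [if_pos rfl] at e1 e2
    rw [if_neg h01] at e3
    -- Evaluated on Q, (w·Q)(w'·Q) = z_{i₀} and (u·Q)(u'·Q) = z_{i₁} are nonzero while (w·Q)(u'·Q) =
    -- 0, which is impossible for a form of rank one.
    rcases mul_eq_zero.1 e3 with h | h
    · rw [h, zero_mul] at e1; exact hz0 e1.symm
    · rw [h, mul_zero] at e2; exact hz1 e2.symm
  · have hsub : J ⊆ (Finset.univ \ {i₀, i₁}) := by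
      intro i hi
      simp only [hJ, Finset.mem_sdiff] at hi ⊢
      exact ⟨Finset.mem_univ _, hi.2⟩
    have hcard : (Finset.univ \ {i₀, i₁} : Finset (Fin n)).card = n - 2 := by
      rw [Finset.card_sdiff_of_subset (Finset.subset_univ _)]
      simp [Finset.card_pair h01]
    have h1 := Finset.card_le_card hsub
    rw [hcard] at h1
    have heq : J = (Finset.univ \ {i₀, i₁}) := Finset.eq_of_subset_of_card_le hsub (by omega)
    refine ⟨?_, by omega⟩
    by_cases h2 : i₂ = i₀
    · rwa [h2]
    by_cases h3 : i₂ = i₁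
    · rwa [h3]
    have : i₂ ∈ J := by rw [heq]; simp [h2, h3]
    simp only [hJ, Finset.mem_sdiff, Finset.mem_filter] at this
    exact this.1.2

end Multisymmetric

/-! ### The dichotomy: permutation or no zero entry -/

namespace Multisymmetric

open Matrix

/-- The exponents that are sums of two elements of `T`, together with the basis vectors. -/
def sumset {r : ℕ} (T : Finset (Fin r → ℕ)) : Finset (Fin r → ℕ) :=
  (T + T) ∪ Finset.univ.image fun k => Pi.single k 1

theorem add_mem_sumset {r : ℕ} {T : Finset (Fin r → ℕ)} {a b : Fin r → ℕ} (ha : a ∈ T)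
    (hb : b ∈ T) : a + b ∈ sumset T :=
  Finset.mem_union_left _ (Finset.add_mem_add ha hb)

theorem single_mem_sumset {r : ℕ} (T : Finset (Fin r → ℕ)) (k : Fin r) :
    Pi.single k 1 ∈ sumset T :=
  Finset.mem_union_right _ (Finset.mem_image_of_mem _ (Finset.mem_univ k))

/-- Orthogonality makes Z a signed permutation matrix, and the exponents e_k give y_j = ε_j x_{π(j)}
with ε_j = ±1. For σ ∈ T the exponent σ + σ has even degree, so its monomial does not see the sign,
while the relation for Z multiplies it by ε_j. As the coordinates of x are nonzero, ε_j = 1. -/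
theorem perm_of_rows_single {n r : ℕ} {F : Type*} [Field F] {x y : Fin n → Fin r → F}
    {T : Finset (Fin r → ℕ)} (hT : T.Nonempty) (hx : ∀ i k, x i k ≠ 0)
    {Z : Matrix (Fin n) (Fin n) F} (hZ : Z * Zᵀ = 1)
    (hZy : ∀ τ ∈ sumset T, ∀ j, mon τ (y j) = ∑ i, Z j i * mon τ (x i))
    {π : Fin n → Fin n} (hπ : ∀ j i, Z j i ≠ 0 → i = π j) :
    ∃ π : Equiv.Perm (Fin n), ∀ j, y j = x (π j) := by
  have hZZ : ∀ j j', ∑ i, Z j i * Z j' i = if j = j' then 1 else 0 := by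
    intro j j'
    have := congrFun (congrFun hZ j) j'
    simpa [Matrix.mul_apply, Matrix.one_apply] using this
  have hz0 : ∀ j i, i ≠ π j → Z j i = 0 := fun j i h => by_contra fun h' => h (hπ j i h')
  have hsum : ∀ j (g : Fin n → F), ∑ i, Z j i * g i = Z j (π j) * g (π j) := by
    intro j g
    refine Finset.sum_eq_single _ (fun i _ hi => by rw [hz0 j i hi, zero_mul]) (by simp)
  have hsq : ∀ j, Z j (π j) * Z j (π j) = 1 := fun j => by
    have := hZZ j j
    rwa [hsum, if_pos rfl] at this
  have hinj : Function.Injective π := by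
    intro j j' h
    by_contra hne
    have := hZZ j j'
    rw [hsum, if_neg hne, h] at this
    rcases mul_eq_zero.1 this with h1 | h1
    · have := hsq j; rw [h, h1, zero_mul] at this; exact zero_ne_one this
    · have := hsq j'; rw [h1, zero_mul] at this; exact zero_ne_one this
  refine ⟨Equiv.ofBijective π (Finite.injective_iff_bijective.1 hinj), fun j => ?_⟩
  have hy : y j = fun k => Z j (π j) * x (π j) k := by
    funext k
    have := hZy _ (single_mem_sumset T k) j
    rwa [hsum, mon_single, mon_single] at this
  obtain ⟨σ, hσ⟩ := hT
  have h1 := hZy _ (add_mem_sumset hσ hσ) j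
  have hmon : mon (σ + σ) (x (π j)) ≠ 0 :=
    Finset.prod_ne_zero_iff.2 fun k _ => pow_ne_zero _ (hx _ _)
  have h2 : Z j (π j) ^ ∑ k, (σ + σ) k = 1 := by
    have : ∑ k, (σ + σ) k = 2 * ∑ k, σ k := by
      rw [Finset.mul_sum]; exact Finset.sum_congr rfl fun k _ => by simp [two_mul]
    rw [this, pow_mul, pow_two, hsq, one_pow]
  rw [hsum, hy, mon_const_mul, h2] at h1
  have h3 : Z j (π j) = 1 := (mul_right_cancel₀ hmon h1).symm
  rw [hy, h3]
  simp

/-- By `support_of_rank_one` a row with a zero entry has exactly one nonzero entry, say in column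
i₀. Orthogonality then makes every other row vanish at i₀, so those rows also have a single nonzero
entry. -/
theorem perm_or_full_support {n r : ℕ} {F : Type*} [Field F] {x y : Fin n → Fin r → F}
    {T : Finset (Fin r → ℕ)} (hT : T.Nonempty) (hTn : T.card ≤ n) (hnT : n + 1 ≤ 2 * T.card)
    (hx : ∀ i k, x i k ≠ 0)
    (hP : ∀ J : T → Fin n, Function.Injective J →
      (Matrix.of fun a b : T => mon b.1 (x (J a))).det ≠ 0)
    {B : Fin n → Fin r → ℕ} (hB : ∀ a, B a ∈ T + T)
    (hdet : (Matrix.of fun i b => mon (B b) (x i)).det ≠ 0)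
    (hm : ∀ τ ∈ T + T, ∀ τ' ∈ sumset T, ∑ i, mon (τ + τ') (x i) = ∑ i, mon (τ + τ') (y i)) :
    (∃ π : Equiv.Perm (Fin n), ∀ j, y j = x (π j)) ∨
    (n + 1 = 2 * T.card ∧ ∃ Z : Matrix (Fin n) (Fin n) F, Z * Zᵀ = 1 ∧
      (∀ τ ∈ sumset T, ∀ j, mon τ (y j) = ∑ i, Z j i * mon τ (x i)) ∧ ∀ j i, Z j i ≠ 0) := by
  obtain ⟨Z, hZ, hZy⟩ := exists_orthogonal_of_moments (W := ↑(T + T)) (W' := ↑(sumset T))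
    (fun τ h τ' h' => hm τ h τ' h') hB (fun a => Finset.mem_union_left _ (hB a)) hdet
  have hZZ : ∀ j j', ∑ i, Z j i * Z j' i = if j = j' then 1 else 0 := by
    intro j j'
    have := congrFun (congrFun hZ j) j'
    simpa [Matrix.mul_apply, Matrix.one_apply] using this
  have krus : ∀ j (i₀ i₁ i₂ : Fin n), i₀ ≠ i₁ → Z j i₀ ≠ 0 → Z j i₁ ≠ 0 →
      Z j i₂ ≠ 0 ∧ n + 1 = 2 * T.card := by
    intro j i₀ i₁ i₂ h01 h0 h1
    have := support_of_rank_one (τ := T) (P := fun i b => mon b.1 (x i)) (by simpa using hTn)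
      hP (z := Z j) (Q := fun b => mon b.1 (y j)) (fun a b => by
        rw [← mon_add, hZy _ (add_mem_sumset a.2 b.2)]
        exact Finset.sum_congr rfl fun i _ => by rw [mon_add]) (by simpa using hnT)
      (i₂ := i₂) h01 h0 h1
    simpa using this
  have hex : ∀ j, ∃ i, Z j i ≠ 0 := by
    intro j
    by_contra! h
    have := hZZ j j
    simp [h] at this
  by_cases hfull : ∀ j i, Z j i ≠ 0
  · by_cases hn : n + 1 = 2 * T.card
    · exact Or.inr ⟨hn, Z, hZ, hZy, hfull⟩
    · left
      refine perm_of_rows_single (π := id) hT hx hZ hZy fun j i h => ?_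
      by_contra hne
      exact hn (krus j i j i hne (hfull _ _) (hfull _ _)).2
  · left
    push Not at hfull
    obtain ⟨j₀, i₁, h1⟩ := hfull
    have single : ∀ j i', Z j i' = 0 → ∀ i i'', Z j i ≠ 0 → Z j i'' ≠ 0 → i = i'' := by
      intro j i' hi' i i'' hi hi''
      by_contra hne
      exact (krus j i i'' i' hne hi hi'').1 hi'
    obtain ⟨i₀, h0⟩ := hex j₀
    have hz : ∀ j, j ≠ j₀ → Z j i₀ = 0 := by
      intro j hj
      have := hZZ j₀ j
      rw [Finset.sum_eq_single i₀ _ (by simp), if_neg (Ne.symm hj)] at this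
      · exact (mul_eq_zero.1 this).resolve_left h0
      · intro i _ hi
        have : Z j₀ i = 0 := by_contra fun h => hi (single j₀ i₁ h1 i i₀ h h0)
        rw [this, zero_mul]
    choose π hπ using hex
    refine perm_of_rows_single (π := π) hT hx hZ hZy fun j i h => ?_
    by_cases hj : j = j₀
    · subst hj; exact single j i₁ h1 i _ h (hπ j)
    · exact single j i₀ (hz j hj) i _ h (hπ j)

end Multisymmetric

/-! ### Excluding full support by differentiation -/

namespace Multisymmetric

open Matrix MvPolynomial

/-- Generic rows cannot be mixed by an orthogonal matrix without zero entries that is compatible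
with `n + r` monomials. -/
theorem false_of_full_support {n r : ℕ} {Ω : Type*} [Field Ω] [Algebra ℚ Ω]
    {p : Fin n → Fin r → Ω}
    (hp : Function.Injective (aeval (fun ik : Fin n × Fin r => p ik.1 ik.2) :
      MvPolynomial (Fin n × Fin r) ℚ →ₐ[ℚ] Ω))
    {D : Fin n → Fin r → Derivation ℚ Ω Ω}
    (hD : ∀ i k i' k', D i k (p i' k') = if i' = i ∧ k' = k then 1 else 0)
    {Z : Matrix (Fin n) (Fin n) Ω} (hZ : Z * Zᵀ = 1) (hfull : ∀ j i, Z j i ≠ 0)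
    {q : Fin n → Fin r → Ω} {e : Fin n ⊕ Fin r → Fin r → ℕ} (he : Function.Injective e)
    (hek : ∀ k, e (Sum.inr k) = Pi.single k 1)
    (hq : ∀ c j, mon (e c) (q j) = ∑ i, Z j i * mon (e c) (p i)) (hn : 2 ≤ n) : False := by
  classical
  have : CharZero Ω := algebraRat.charZero Ω
  have hZZ : ∀ j, ∑ i, Z j i * Z j i = 1 := by
    intro j
    have := congrFun (congrFun hZ j) j
    simpa [Matrix.mul_apply] using this
  set ev : (Fin n ⊕ Fin r → Ω) → Fin n → Ω := fun h i => ∑ c, h c * mon (e c) (p i) with hev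
  set gr : (Fin n ⊕ Fin r → Ω) → Fin r → Fin n → Ω :=
    fun h k i => ∑ c, h c * dmon (e c) k (p i) with hgr
  set gq : (Fin n ⊕ Fin r → Ω) → Fin r → Fin n → Ω :=
    fun h k j => ∑ c, h c * dmon (e c) k (q j) with hgq
  have ev_sub : ∀ h h' i, ev (h - h') i = ev h i - ev h' i := fun h h' i => by
    simp only [hev, Pi.sub_apply, sub_mul, Finset.sum_sub_distrib]
  have gr_sub : ∀ h h' k i, gr (h - h') k i = gr h k i - gr h' k i := fun h h' k i => by
    simp only [hgr, Pi.sub_apply, sub_mul, Finset.sum_sub_distrib]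
  have ev_sum : ∀ (h : Fin n → Fin n ⊕ Fin r → Ω) i, ev (∑ j, h j) i = ∑ j, ev (h j) i := by
    intro h i
    simp only [hev, Finset.sum_apply, Finset.sum_mul]
    exact Finset.sum_comm
  have gr_sum : ∀ (h : Fin n → Fin n ⊕ Fin r → Ω) k i,
      gr (∑ j, h j) k i = ∑ j, gr (h j) k i := by
    intro h k i
    simp only [hgr, Finset.sum_apply, Finset.sum_mul]
    exact Finset.sum_comm
  -- differentiating the relations
  have star : ∀ j i k h c, (∀ l, ev h l = c * Z j l) →
      ∑ m, gq h m j * D i k (q j m) = Z j i * gr h k i := by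
    intro j i k h c hc
    have h1 : ∀ b, ∑ m, dmon (e b) m (q j) * D i k (q j m) =
        Z j i * dmon (e b) k (p i) + ∑ l, D i k (Z j l) * mon (e b) (p l) := by
      intro b
      have h2 : ∀ l, D i k (mon (e b) (p l)) = if l = i then dmon (e b) k (p i) else 0 := by
        intro l
        rw [derivation_mon]
        simp only [hD]
        split_ifs with h
        · subst h; simp
        · simp [h]
      rw [← derivation_mon, hq, map_sum]
      simp only [Derivation.leibniz, smul_eq_mul, h2, Finset.sum_add_distrib]
      congr 1
      · simp
      · exact Finset.sum_congr rfl fun l _ => mul_comm _ _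
    -- Differentiating the unit length of row j makes the unknown derivatives of Z drop out whenever
    -- the values of h at the p_l are proportional to that row.
    have h3 : ∑ l, D i k (Z j l) * Z j l = 0 := by
      have := congrArg (D i k) (hZZ j)
      rw [map_sum, Derivation.map_one_eq_zero] at this
      simp only [Derivation.leibniz, smul_eq_mul, ← two_mul, ← Finset.mul_sum] at this
      rw [← (mul_eq_zero.1 this).resolve_left two_ne_zero]
      exact Finset.sum_congr rfl fun l _ => mul_comm _ _
    calc ∑ m, gq h m j * D i k (q j m)
        = ∑ b, h b * ∑ m, dmon (e b) m (q j) * D i k (q j m) := by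
          simp only [hgq, Finset.sum_mul, Finset.mul_sum]
          rw [Finset.sum_comm]
          exact Finset.sum_congr rfl fun _ _ => Finset.sum_congr rfl fun _ _ => by ring
      _ = Z j i * gr h k i + ∑ l, D i k (Z j l) * ev h l := by
          simp only [h1, mul_add, Finset.sum_add_distrib]
          congr 1
          · simp only [hgr, Finset.mul_sum]
            exact Finset.sum_congr rfl fun _ _ => by ring
          · simp only [hev, Finset.mul_sum]
            rw [Finset.sum_comm]
            exact Finset.sum_congr rfl fun _ _ => Finset.sum_congr rfl fun _ _ => by ring
      _ = Z j i * gr h k i := by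
          simp only [hc]
          have : ∑ l, D i k (Z j l) * (c * Z j l) = c * ∑ l, D i k (Z j l) * Z j l := by
            rw [Finset.mul_sum]; exact Finset.sum_congr rfl fun _ _ => by ring
          rw [this, h3, mul_zero, add_zero]
  let i₀ : Fin n := ⟨0, by omega⟩
  have hdet : (jetMatrix e i₀ p).det ≠ 0 := by
    rw [← aeval_det_jetMatrix]
    intro h
    exact det_jetMatrix_ne_zero he hek i₀ ((map_eq_zero_iff _ hp).1 h)
  -- A combination h of the n + r monomials can be given arbitrary values at all the points and an
  -- arbitrary gradient at p_{i₀}.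
  have surj : ∀ (u : Fin n → Ω) (w : Fin r → Ω), ∃ h, (∀ i, ev h i = u i) ∧
      ∀ k, gr h k i₀ = w k := by
    intro u w
    have hu : IsUnit (jetMatrix e i₀ p) := by
      rw [Matrix.isUnit_iff_isUnit_det]; exact isUnit_iff_ne_zero.2 hdet
    obtain ⟨h, hh⟩ := Matrix.mulVec_surjective_iff_isUnit.2 hu (Sum.elim u w)
    refine ⟨h, fun i => ?_, fun k => ?_⟩
    · have := congrFun hh (Sum.inl i)
      simpa [jetMatrix, Matrix.mulVec, dotProduct, hev, mul_comm] using this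
    · have := congrFun hh (Sum.inr k)
      simpa [jetMatrix, Matrix.mulVec, dotProduct, hgr, mul_comm] using this
  -- the basic vanishing statement
  have van : ∀ j h c, (∀ l, ev h l = c * Z j l) → (∀ k, gr h k i₀ = 0) →
      ∀ i k, gr h k i = 0 := by
    intro j h c hc h0
    -- Functions with zero values and unit gradients at p_{i₀} show that the Jacobian of q_j with
    -- respect to p_{i₀} is invertible. Hence the gradient of h vanishes at q_j, and by `star` at
    -- every p_i, since Z_ji ≠ 0.
    choose H hH hH' using fun a : Fin r => surj 0 (Pi.single a 1)
    let A : Matrix (Fin r) (Fin r) Ω := Matrix.of fun a m => gq (H a) m j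
    let G : Matrix (Fin r) (Fin r) Ω := Matrix.of fun m k => D i₀ k (q j m)
    have hAG : ((Z j i₀)⁻¹ • A) * G = 1 := by
      ext a k
      have h1 := star j i₀ k (H a) 0 (fun l => by rw [hH]; simp)
      rw [hH'] at h1
      rw [Matrix.smul_mul, Matrix.smul_apply, Matrix.mul_apply]
      simp only [A, G, Matrix.of_apply]
      rw [h1, smul_eq_mul, inv_mul_cancel_left₀ (hfull _ _), Matrix.one_apply, Pi.single_apply]
      simp [eq_comm]
    have hGA := mul_eq_one_comm.1 hAG
    have hgz : (fun m => gq h m j) ᵥ* G = 0 := by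
      ext k
      have h1 := star j i₀ k h c hc
      rw [h0, mul_zero] at h1
      simpa [Matrix.vecMul, dotProduct, G] using h1
    have hg0 : (fun m => gq h m j) = 0 := by
      rw [← Matrix.vecMul_one (fun m => gq h m j), ← hGA, ← Matrix.vecMul_vecMul, hgz,
        Matrix.zero_vecMul]
    intro i k
    have h1 := star j i k h c hc
    have h2 : ∀ m, gq h m j = 0 := fun m => congrFun hg0 m
    simp only [h2, zero_mul, Finset.sum_const_zero] at h1
    exact (mul_eq_zero.1 h1.symm).resolve_left (hfull _ _)
  -- The rows of Z span all value vectors, so the restriction on the values of h can be removed by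
  -- subtracting functions treated by `van`.
  have van' : ∀ h, (∀ k, gr h k i₀ = 0) → ∀ i k, gr h k i = 0 := by
    intro h h0 i k
    have hZu : IsUnit Z := IsUnit.of_mul_eq_one _ hZ
    obtain ⟨c, hc⟩ := Matrix.vecMul_surjective_iff_isUnit.2 hZu (ev h)
    choose H hH hH' using fun j => surj (fun l => c j * Z j l) 0
    have h1 : ∀ i, ev (∑ j, H j) i = ev h i := by
      intro i
      rw [ev_sum, ← hc]
      simp [hH, Matrix.vecMul, dotProduct]
    have h2 := van ⟨0, by omega⟩ (h - ∑ j, H j) 0 (fun l => by rw [ev_sub, h1]; simp)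
      (fun k => by rw [gr_sub, gr_sum, h0]; simp [hH']) i k
    have h3 : ∀ j, gr (H j) k i = 0 := fun j =>
      van j (H j) (c j) (hH j) (fun k => hH' j k) i k
    rw [gr_sub, gr_sum] at h2
    simpa [h3] using h2
  -- a monomial of degree at least two
  obtain ⟨a, ha⟩ : ∃ a : Fin n, e (Sum.inl a) ≠ 0 := by
    by_contra! h
    have := he ((h i₀).trans (h ⟨1, by omega⟩).symm)
    simp [i₀] at this
  obtain ⟨k, hk⟩ : ∃ k, e (Sum.inl a) k ≠ 0 := by
    by_contra! h
    exact ha (funext h)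
  let i₁ : Fin n := ⟨1, by omega⟩
  -- Applied to a monomial minus its linear part at p_{i₀}: its gradient would be the same at all
  -- the points.
  have h4 := van' (Pi.single (Sum.inl a) 1 -
      ∑ k, Pi.single (Sum.inr k) (dmon (e (Sum.inl a)) k (p i₀)))
  have single : ∀ c (t : Ω) k i, gr (Pi.single c t) k i = t * dmon (e c) k (p i) := by
    intro c t k i
    simp only [hgr]
    rw [Finset.sum_eq_single c]
    · simp
    · intro b _ hb; simp [hb]
    · simp
  have gr_sum' : ∀ (h : Fin r → Fin n ⊕ Fin r → Ω) k i,
      gr (∑ j, h j) k i = ∑ j, gr (h j) k i := by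
    intro h k i
    simp only [hgr, Finset.sum_apply, Finset.sum_mul]
    exact Finset.sum_comm
  have dsingle : ∀ (k' k : Fin r) (u : Fin r → Ω),
      dmon (Pi.single k' 1 : Fin r → ℕ) k u = if k' = k then 1 else 0 := by
    intro k' k u
    by_cases h : k' = k
    · subst h; simp [dmon]
    · simp [dmon, h, Ne.symm h]
  have val : ∀ k i, gr (Pi.single (Sum.inl a) 1 -
      ∑ k, Pi.single (Sum.inr k) (dmon (e (Sum.inl a)) k (p i₀))) k i =
      dmon (e (Sum.inl a)) k (p i) - dmon (e (Sum.inl a)) k (p i₀) := by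
    intro k i
    rw [gr_sub, gr_sum', single]
    simp [single, hek, dsingle]
  have h5 := h4 (fun k => by rw [val, sub_self]) i₁ k
  rw [val] at h5
  have h6 : aeval (fun ik : Fin n × Fin r => p ik.1 ik.2)
      (dmon (e (Sum.inl a)) k (genericRow i₁) - dmon (e (Sum.inl a)) k (genericRow i₀)) = 0 := by
    rw [← h5]
    simp [dmon, map_mon, genericRow]
  have h7 := (map_eq_zero_iff _ hp).1 h6
  obtain ⟨k', hk'⟩ : ∃ k', (e (Sum.inl a) - Pi.single k 1 : Fin r → ℕ) k' ≠ 0 := by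
    by_contra! h
    have h8 : e (Sum.inl a) = Pi.single k 1 := by
      funext l
      have h9 := h l
      by_cases hl : l = k
      · subst hl; simp at h9 ⊢; omega
      · simpa [hl] using h9
    rw [← hek] at h8
    exact absurd (he h8) (by simp)
  -- Specializing row i₀ to 0 and all others to 1 separates the two derivatives, because the derived
  -- monomial is not constant.
  have h8 := congrArg (aeval (fun ik : Fin n × Fin r => if ik.1 = i₀ then (0 : ℚ) else 1)) h7
  have h9 : mon (e (Sum.inl a) - Pi.single k 1) (fun _ => (0 : ℚ)) = 0 :=
    Finset.prod_eq_zero (Finset.mem_univ k') (zero_pow hk')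
  have h10 : i₁ ≠ i₀ := by simp [i₀, i₁]
  simp [dmon, map_mon, genericRow, h9, h10, hk] at h8

end Multisymmetric

/-! ### Newton's identities and exponents on a line -/

namespace Multisymmetric

open Matrix MvPolynomial

/-- Newton's identities recover the elementary symmetric functions recursively from the power sums,
in characteristic zero. -/
theorem esymm_eq_of_sum_pow_eq {n N : ℕ} {F : Type*} [Field F] [Algebra ℚ F] {u v : Fin n → F}
    (h : ∀ k, 1 ≤ k → k ≤ N → ∑ i, u i ^ k = ∑ i, v i ^ k) :
    ∀ k ≤ N, aeval u (esymm (Fin n) ℚ k) = aeval v (esymm (Fin n) ℚ k) := by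
  have : CharZero F := algebraRat.charZero F
  intro k
  induction k using Nat.strong_induction_on with
  | _ k ih =>
    intro hk
    rcases Nat.eq_zero_or_pos k with rfl | hk0
    · simp
    have h1 : ∀ w : Fin n → F, (k : F) * aeval w (esymm (Fin n) ℚ k) = (-1) ^ (k + 1) *
        ∑ a ∈ Finset.HasAntidiagonal.antidiagonal k with a.1 < k,
          (-1) ^ a.1 * aeval w (esymm (Fin n) ℚ a.1) * ∑ i, w i ^ a.2 := by
      intro w
      have := congrArg (aeval w) (mul_esymm_eq_sum (Fin n) ℚ k)
      simpa [psum] using this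
    have h2 : (k : F) * aeval u (esymm (Fin n) ℚ k) = (k : F) * aeval v (esymm (Fin n) ℚ k) := by
      rw [h1, h1]
      congr 1
      refine Finset.sum_congr rfl fun a ha => ?_
      rw [Finset.mem_filter, Finset.HasAntidiagonal.mem_antidiagonal] at ha
      rw [ih a.1 ha.2 (by omega), h a.2 (by omega) (by omega)]
    exact mul_left_cancel₀ (Nat.cast_ne_zero.2 hk0.ne') h2

theorem prod_sub_eq_sum_esymm {n : ℕ} {F : Type*} [Field F] [Algebra ℚ F] (u : Fin n → F)
    (t : F) : ∏ i, (t - u i) = ∑ j ∈ Finset.range (n + 1),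
      (-1) ^ j * (aeval u (esymm (Fin n) ℚ j) * t ^ (n - j)) := by
  have h := congrArg (Polynomial.eval t)
    (Multiset.prod_X_sub_X_eq_sum_esymm (Finset.univ.val.map u))
  rw [Polynomial.eval_multiset_prod, Multiset.map_map, Multiset.map_map] at h
  simp only [Polynomial.eval_finsetSum, Multiset.card_map, Finset.card_val, Finset.card_univ,
    Fintype.card_fin] at h
  simp only [aeval_esymm_eq_multiset_esymm]
  have hL : (Finset.univ.val.map fun i => t - u i).prod = (Multiset.map
      ((Polynomial.eval t ∘ fun t => Polynomial.X - Polynomial.C t) ∘ u) Finset.univ.val).prod := by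
    congr 1
    exact Multiset.map_congr rfl fun i _ => by simp
  refine (hL.trans h).trans (Finset.sum_congr rfl fun i _ => ?_)
  simp

/-- Equality of the first `n - 1` power sums makes the values of `∏ (t - uᵢ)` at the `vⱼ`
independent of `j`. -/
theorem prod_sub_eq_of_sum_pow_eq {n : ℕ} {F : Type*} [Field F] [Algebra ℚ F] {u v : Fin n → F}
    (h : ∀ k, 1 ≤ k → k ≤ n - 1 → ∑ i, u i ^ k = ∑ i, v i ^ k) (j j' : Fin n) :
    ∏ i, (v j - u i) = ∏ i, (v j' - u i) := by
  have hn : 0 < n := j.pos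
  -- The monic polynomials with roots u and v differ at most in the constant term; the second one
  -- vanishes at v_j.
  have key : ∀ j, ∏ i, (v j - u i) =
      (-1) ^ n * (aeval u (esymm (Fin n) ℚ n) - aeval v (esymm (Fin n) ℚ n)) := by
    intro j
    have h0 : ∏ i, (v j - v i) = 0 := Finset.prod_eq_zero (Finset.mem_univ j) (sub_self _)
    rw [← sub_zero (∏ i, (v j - u i)), ← h0, prod_sub_eq_sum_esymm, prod_sub_eq_sum_esymm,
      ← Finset.sum_sub_distrib, Finset.sum_range_succ, Finset.sum_eq_zero, zero_add]
    · simp; ring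
    · intro i hi
      rw [Finset.mem_range] at hi
      rw [esymm_eq_of_sum_pow_eq h i (by omega), sub_self]
  rw [key, key]

theorem exists_eq_of_sum_pow_eq {n : ℕ} {F : Type*} [Field F] [Algebra ℚ F] {u v : Fin n → F}
    (h : ∀ k, 1 ≤ k → k ≤ n → ∑ i, u i ^ k = ∑ i, v i ^ k) (j : Fin n) : ∃ i, v j = u i := by
  have h0 : ∏ i, (v j - v i) = 0 := Finset.prod_eq_zero (Finset.mem_univ j) (sub_self _)
  have h1 : ∏ i, (v j - u i) = 0 := by
    rw [← h0, prod_sub_eq_sum_esymm, prod_sub_eq_sum_esymm]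
    refine Finset.sum_congr rfl fun i hi => ?_
    rw [Finset.mem_range] at hi
    rw [esymm_eq_of_sum_pow_eq h i (by omega)]
  obtain ⟨i, -, hi⟩ := Finset.prod_eq_zero_iff.1 h1
  exact ⟨i, sub_eq_zero.1 hi⟩

/-- Orthogonal invariance of the dot product. It yields moments of products of two functions that
are both transported by Z. -/
theorem sum_mul_eq_of_orthogonal {n : ℕ} {F : Type*} [Field F] {Z : Matrix (Fin n) (Fin n) F}
    (hZ : Z * Zᵀ = 1) {f g f' g' : Fin n → F} (hf : ∀ j, f' j = ∑ i, Z j i * f i)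
    (hg : ∀ j, g' j = ∑ i, Z j i * g i) : ∑ i, f i * g i = ∑ j, f' j * g' j := by
  have h1 : f' = Z *ᵥ f := funext hf
  have h2 : g' = Z *ᵥ g := funext hg
  change f ⬝ᵥ g = f' ⬝ᵥ g'
  rw [h1, h2, Matrix.dotProduct_mulVec, ← Matrix.mulVec_transpose, mulVec_mulVec,
    mul_eq_one_comm.1 hZ, one_mulVec]

theorem mon_pi_single {r : ℕ} {A : Type*} [CommSemiring A] (k : Fin r) (a : ℕ) (p : Fin r → A) :
    mon (Pi.single k a) p = p k ^ a := by
  rw [mon, Finset.prod_eq_single k]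
  · simp
  · intro b _ hb; simp [hb]
  · simp

/-- The case of exponents on a coordinate line. -/
theorem false_of_full_support_of_line {n r : ℕ} {F : Type*} [Field F] [Algebra ℚ F]
    {x y : Fin n → Fin r → F} {Z : Matrix (Fin n) (Fin n) F} (hZ : Z * Zᵀ = 1)
    (hfull : ∀ j i, Z j i ≠ 0) (hn : 2 ≤ n) {k : Fin r}
    (hdet : (Matrix.of fun i b : Fin n => mon (Pi.single k (b : ℕ)) (x i)).det ≠ 0)
    (hZy : ∀ a < n, ∀ j, mon (Pi.single k a) (y j) = ∑ i, Z j i * mon (Pi.single k a) (x i)) :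
    False := by
  -- The power b = a + 1 is the product of the exponents a ≤ n - 1 and 1, both transported by Z, so
  -- power sums agree up to degree n.
  have hpow : ∀ b, 1 ≤ b → b ≤ n → ∑ i, x i k ^ b = ∑ i, y i k ^ b := by
    intro b hb1 hbn
    obtain ⟨a, rfl⟩ : ∃ a, b = a + 1 := ⟨b - 1, by omega⟩
    have := sum_mul_eq_of_orthogonal hZ (hZy a (by omega)) (hZy 1 (by omega))
    simpa [mon_pi_single, pow_succ] using this
  let j : Fin n := ⟨0, by omega⟩
  obtain ⟨i, hi⟩ := exists_eq_of_sum_pow_eq (u := fun i => x i k) (v := fun i => y i k) hpow j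
  have h1 := row_eq_single (B := fun b : Fin n => Pi.single k (b : ℕ)) hdet (z := Z j) (i₀ := i)
    (fun b => by rw [← hZy b b.2 j, mon_pi_single, mon_pi_single, ← hi])
  obtain ⟨i', hi'⟩ : ∃ i' : Fin n, i' ≠ i := by
    have : Nontrivial (Fin n) := Fin.nontrivial_iff_two_le.2 hn
    exact exists_ne i
  exact hfull j i' (by rw [h1]; simp [hi'])

end Multisymmetric

/-! ### Five points in the plane -/

namespace Multisymmetric

open Matrix MvPolynomial

theorem wedge_eq_zero_of_wedge {F : Type*} [Field F] {a₁ a₂ b₁ b₂ c₁ c₂ : F}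
    (hc : c₁ ≠ 0 ∨ c₂ ≠ 0) (ha : a₁ * c₂ - a₂ * c₁ = 0) (hb : b₁ * c₂ - b₂ * c₁ = 0) :
    a₁ * b₂ - a₂ * b₁ = 0 := by
  rcases hc with hc | hc
  · refine (mul_eq_zero.1 (?_ : c₁ * (a₁ * b₂ - a₂ * b₁) = 0)).resolve_left hc
    linear_combination b₁ * ha - a₁ * hb
  · refine (mul_eq_zero.1 (?_ : c₂ * (a₁ * b₂ - a₂ * b₁) = 0)).resolve_left hc
    linear_combination b₂ * ha - a₂ * hb

/-- Five generic points of the plane cannot be mixed by an orthogonal matrix compatible with the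
monomials of degree at most two. -/
theorem false_of_plane_quintuple {Ω : Type*} [Field Ω] [Algebra ℚ Ω] {u w u' w' : Fin 5 → Ω}
    {Du Dw : Fin 5 → Derivation ℚ Ω Ω}
    (hDuu : ∀ i j, Du i (u j) = if j = i then 1 else 0) (hDuw : ∀ i j, Du i (w j) = 0)
    (hDwu : ∀ i j, Dw i (u j) = 0) (hDww : ∀ i j, Dw i (w j) = if j = i then 1 else 0)
    {Z : Matrix (Fin 5) (Fin 5) Ω} (hZ : Z * Zᵀ = 1) (h1 : ∀ j, (1 : Ω) = ∑ i, Z j i * 1)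
    (hu : ∀ j, u' j = ∑ i, Z j i * u i) (hw : ∀ j, w' j = ∑ i, Z j i * w i)
    (huu : ∀ j, u' j * u' j = ∑ i, Z j i * (u i * u i))
    (huw : ∀ j, u' j * w' j = ∑ i, Z j i * (u i * w i))
    (hww : ∀ j, w' j * w' j = ∑ i, Z j i * (w i * w i))
    (hne : ∀ i j, u i - u' j ≠ 0 ∨ w i - w' j ≠ 0)
    (hne' : u' 1 - u' 0 ≠ 0 ∨ w' 1 - w' 0 ≠ 0) : False := by
  classical
  -- the power sums of linear forms
  have hlin : ∀ a b : Ω, ∀ k, 1 ≤ k → k ≤ 4 →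
      ∑ i, (a * u i + b * w i) ^ k = ∑ i, (a * u' i + b * w' i) ^ k := by
    intro a b
    have e1 : ∀ j, a * u' j + b * w' j = ∑ i, Z j i * (a * u i + b * w i) := fun j => by
      rw [hu, hw, Finset.mul_sum, Finset.mul_sum, ← Finset.sum_add_distrib]
      exact Finset.sum_congr rfl fun i _ => by ring
    have e2 : ∀ j, (a * u' j + b * w' j) ^ 2 = ∑ i, Z j i * (a * u i + b * w i) ^ 2 := fun j => by
      have : (a * u' j + b * w' j) ^ 2 =
        a ^ 2 * (u' j * u' j) + 2 * a * b * (u' j * w' j) + b ^ 2 * (w' j * w' j) := by ring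
      rw [this, huu, huw, hww, Finset.mul_sum, Finset.mul_sum, Finset.mul_sum,
        ← Finset.sum_add_distrib, ← Finset.sum_add_distrib]
      exact Finset.sum_congr rfl fun i _ => by ring
    intro k hk1 hk4
    have hk : k = 1 ∨ k = 2 ∨ k = 3 ∨ k = 4 := by omega
    rcases hk with rfl | rfl | rfl | rfl
    · simpa using sum_mul_eq_of_orthogonal hZ e1 h1
    · simpa using sum_mul_eq_of_orthogonal hZ e2 h1
    · have := sum_mul_eq_of_orthogonal hZ e1 e2
      simpa only [pow_succ' _ 2] using this
    · have := sum_mul_eq_of_orthogonal hZ e2 e2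
      simpa only [← pow_add] using this
  -- Write P_i = (u_i, w_i) and Q_j = (u'_j, w'_j). For a linear form vanishing on P_i - Q_1, the
  -- product of its values at Q_j - P_l over all l does not depend on j and is zero for j = 1. Thus
  -- some P_l - Q_0 is parallel to P_i - Q_1.
  have par : ∀ i, ∃ l, (u i - u' 1) * (w l - w' 0) - (w i - w' 1) * (u l - u' 0) = 0 := by
    intro i
    have h2 := prod_sub_eq_of_sum_pow_eq (n := 5) (u := fun l => (w i - w' 1) * u l + -(u i - u' 1) * w l)
      (v := fun l => (w i - w' 1) * u' l + -(u i - u' 1) * w' l) (hlin (w i - w' 1) (-(u i - u' 1))) 1 0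
    have h3 : ∏ i', ((w i - w' 1) * u' 1 + -(u i - u' 1) * w' 1 -
        ((w i - w' 1) * u i' + -(u i - u' 1) * w i')) = 0 :=
      Finset.prod_eq_zero (Finset.mem_univ i) (by ring)
    rw [h3] at h2
    obtain ⟨l, -, hl⟩ := Finset.prod_eq_zero_iff.1 h2.symm
    exact ⟨l, by linear_combination hl⟩
  -- a derivation killing two points and satisfying five linear conditions
  let A : Fin 5 → Ω := fun i =>
    if (u i - u' 0) * (w' 1 - w' 0) - (w i - w' 0) * (u' 1 - u' 0) = 0 then
      (if u' 1 - u' 0 ≠ 0 then 1 else 0) else w i - w' 0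
  let B : Fin 5 → Ω := fun i =>
    if (u i - u' 0) * (w' 1 - w' 0) - (w i - w' 0) * (u' 1 - u' 0) = 0 then
      (if u' 1 - u' 0 ≠ 0 then 0 else 1) else -(u i - u' 0)
  let E : (Fin 5 → Ω) × (Fin 5 → Ω) →ₗ[Ω] Derivation ℚ Ω Ω :=
    (Fintype.linearCombination Ω Du).coprod (Fintype.linearCombination Ω Dw)
  have hE : ∀ c f, E c f = ∑ i, c.1 i * Du i f + ∑ i, c.2 i * Dw i f := by
    intro c f
    have hsum : ∀ (s : Finset (Fin 5)) (d : Fin 5 → Derivation ℚ Ω Ω),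
        (∑ i ∈ s, d i) f = ∑ i ∈ s, d i f := fun s d => by
      induction s using Finset.induction_on with
      | empty => simp
      | insert a s ha ih => rw [Finset.sum_insert ha, Finset.sum_insert ha, ← ih]; rfl
    simp [E, Fintype.linearCombination_apply, hsum]
  have hEu : ∀ c i, E c (u i) = c.1 i := fun c i => by simp [hE, hDuu, hDwu]
  have hEw : ∀ c i, E c (w i) = c.2 i := fun c i => by simp [hE, hDuw, hDww]
  let Φ : (Fin 5 → Ω) × (Fin 5 → Ω) →ₗ[Ω] (Fin 5 → Ω) × (Fin 4 → Ω) :=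
    { toFun := fun c => (fun i => A i * c.1 i + B i * c.2 i,
        fun t => E c (![u' 0, w' 0, u' 1, w' 1] t))
      map_add' := fun c d => by
        ext t
        · simp; ring
        · simp
      map_smul' := fun s c => by
        ext t
        · simp; ring
        · simp }
  -- There are ten unknowns, the derivatives of the coordinates of the P_i, and nine equations: four
  -- fix Q_0 and Q_1, and one for each i makes the derivative of P_i parallel to P_i - Q_0. If P_i
  -- is collinear with Q_0 and Q_1, the last equation instead kills one coordinate of the
  -- derivative.
  have hker : LinearMap.ker Φ ≠ ⊥ := by
    apply LinearMap.ker_ne_bot_of_finrank_lt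
    simp
  obtain ⟨c, hc, hc0⟩ := Submodule.exists_mem_ne_zero_of_ne_bot hker
  rw [LinearMap.mem_ker] at hc
  have hAB : ∀ i, A i * c.1 i + B i * c.2 i = 0 := fun i => congrFun (congrArg Prod.fst hc) i
  have hq : ∀ t, E c (![u' 0, w' 0, u' 1, w' 1] t) = 0 :=
    fun t => congrFun (congrArg Prod.snd hc) t
  have hu0 : E c (u' 0) = 0 := hq 0
  have hw0 : E c (w' 0) = 0 := hq 1
  have hu1 : E c (u' 1) = 0 := hq 2
  have hw1 : E c (w' 1) = 0 := hq 3
  -- the collinear case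
  have col : ∀ i, (u i - u' 0) * (w' 1 - w' 0) - (w i - w' 0) * (u' 1 - u' 0) = 0 →
      c.1 i = 0 ∧ c.2 i = 0 := by
    intro i hi
    have h2 := congrArg (E c) hi
    simp only [map_sub, Derivation.leibniz, map_zero, hu0, hu1, hw0, hw1, hEu, hEw, smul_eq_mul]
      at h2
    have h3 := hAB i
    simp only [A, B, if_pos hi] at h3
    by_cases h4 : u' 1 - u' 0 = 0
    · have h5 := hne'.resolve_left (not_not.2 h4)
      simp only [h4, ne_eq, not_true_eq_false, if_false] at h3
      have h6 : c.2 i = 0 := by linear_combination h3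
      have h7 : c.1 i * (w' 1 - w' 0) = 0 := by
        linear_combination h2 + (u' 1 - u' 0) * h6
      exact ⟨(mul_eq_zero.1 h7).resolve_right h5, h6⟩
    · simp only [ne_eq, h4, not_false_eq_true, if_true] at h3
      have h6 : c.1 i = 0 := by linear_combination h3
      have h7 : c.2 i * (u' 1 - u' 0) = 0 := by
        linear_combination -h2 + (w' 1 - w' 0) * h6
      exact ⟨h6, (mul_eq_zero.1 h7).resolve_right h4⟩
  have cond : ∀ i, c.1 i * (w i - w' 0) - c.2 i * (u i - u' 0) = 0 := by
    intro i
    by_cases hi : (u i - u' 0) * (w' 1 - w' 0) - (w i - w' 0) * (u' 1 - u' 0) = 0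
    · rw [(col i hi).1, (col i hi).2]; ring
    · have h3 := hAB i
      simp only [A, B, if_neg hi] at h3
      linear_combination h3
  have all : ∀ i, c.1 i = 0 ∧ c.2 i = 0 := by
    intro i
    by_cases hi : (u i - u' 0) * (w' 1 - w' 0) - (w i - w' 0) * (u' 1 - u' 0) = 0
    · exact col i hi
    obtain ⟨l, hl⟩ := par i
    have h2 := congrArg (E c) hl
    simp only [map_sub, Derivation.leibniz, map_zero, hu0, hu1, hw0, hw1, hEu, hEw, smul_eq_mul]
      at h2
    -- The direction of P_l - Q_0 is constant, so that of P_i - Q_1 is too. The derivative of P_i is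
    -- then parallel to both P_i - Q_0 and P_i - Q_1, which are independent, so it vanishes.
    have h3 : (u i - u' 1) * c.2 l - (w i - w' 1) * c.1 l = 0 :=
      wedge_eq_zero_of_wedge (hne l 0) hl (cond l)
    have h4 : c.1 i * (w l - w' 0) - c.2 i * (u l - u' 0) = 0 := by
      linear_combination h2 - h3
    have h5 : c.1 i * (w i - w' 1) - c.2 i * (u i - u' 1) = 0 :=
      wedge_eq_zero_of_wedge (hne l 0) h4 hl
    have h6 := cond i
    refine ⟨(mul_eq_zero.1 (?_ : _ * c.1 i = 0)).resolve_left hi,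
      (mul_eq_zero.1 (?_ : _ * c.2 i = 0)).resolve_left hi⟩
    · linear_combination (u i - u' 1) * h6 - (u i - u' 0) * h5
    · linear_combination (w i - w' 1) * h6 - (w i - w' 0) * h5
  exact hc0 (Prod.ext (funext fun i => (all i).1) (funext fun i => (all i).2))

end Multisymmetric

/-! ### A Freiman-type lower bound for sums of exponents -/

namespace Multisymmetric

/-- The graded lexicographic order on exponents. -/
noncomputable def gradedLex {r : ℕ} (τ : Fin r → ℕ) : DegLex (Fin r →₀ ℕ) :=
  toDegLex (Finsupp.equivFunOnFinite.symm τ)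

theorem gradedLex_injective {r : ℕ} : Function.Injective (gradedLex (r := r)) := fun _ _ h =>
  Finsupp.equivFunOnFinite.symm.injective (toDegLex_injective h)

theorem gradedLex_add {r : ℕ} (σ τ : Fin r → ℕ) :
    gradedLex (σ + τ) = gradedLex σ + gradedLex τ := by
  rw [gradedLex, gradedLex, gradedLex, ← toDegLex_add]
  congr 1
  ext; simp

theorem sum_le_of_gradedLex_le {r : ℕ} {σ τ : Fin r → ℕ} (h : gradedLex σ ≤ gradedLex τ) :
    ∑ k, σ k ≤ ∑ k, τ k := by
  have := Finsupp.DegLex.monotone_degree h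
  simpa [gradedLex, Finsupp.degree_eq_sum] using this

theorem mem_sumset_iff {r : ℕ} {T : Finset (Fin r → ℕ)} {τ : Fin r → ℕ} : τ ∈ sumset T ↔
    (∃ c ∈ T, ∃ c' ∈ T, c + c' = τ) ∨ ∃ k, Pi.single k 1 = τ := by
  simp [sumset, Finset.mem_add]

theorem card_sumset_erase {r : ℕ} {T G : Finset (Fin r → ℕ)} {b : Fin r → ℕ} (hb : b ∈ T)
    (hG : G ⊆ T) (h : ∀ c ∈ G, b + c ∉ sumset (T.erase b)) :
    (sumset (T.erase b)).card + G.card ≤ (sumset T).card := by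
  have h1 : (G.image fun c => b + c).card = G.card :=
    Finset.card_image_of_injective _ fun c c' h => add_left_cancel h
  rw [← h1, ← Finset.card_union_of_disjoint]
  · apply Finset.card_le_card
    intro τ hτ
    rcases Finset.mem_union.1 hτ with hτ | hτ
    · rw [mem_sumset_iff] at hτ ⊢
      rcases hτ with ⟨c, hc, c', hc', rfl⟩ | hτ
      · exact Or.inl ⟨c, Finset.mem_of_mem_erase hc, c', Finset.mem_of_mem_erase hc', rfl⟩
      · exact Or.inr hτ
    · obtain ⟨c, hc, rfl⟩ := Finset.mem_image.1 hτ
      exact add_mem_sumset hb (hG hc)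
  · rw [Finset.disjoint_right]
    intro τ hτ
    obtain ⟨c, hc, rfl⟩ := Finset.mem_image.1 hτ
    exact h c hc

theorem sum_pi_single {r : ℕ} (k : Fin r) (a : ℕ) : ∑ l, (Pi.single k a : Fin r → ℕ) l = a := by
  simp [Pi.single_apply]

theorem exists_eq_single_of_sum_eq_one {r : ℕ} {τ : Fin r → ℕ} (h : ∑ k, τ k = 1) :
    ∃ k, τ = Pi.single k 1 := by
  by_contra! h'
  exact mon_sum_ne_one h' h

theorem eq_zero_of_sum_eq_zero {r : ℕ} {τ : Fin r → ℕ} (h : ∑ k, τ k = 0) : τ = 0 :=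
  funext fun k => Finset.sum_eq_zero_iff.1 h k (Finset.mem_univ k)

/-- A lower bound for the number of sums of two elements of `T`, counted together with the basis
vectors, with its two exceptions. -/
theorem card_sumset {r : ℕ} (T : Finset (Fin r → ℕ)) (hT : T.Nonempty) :
    2 * T.card + r ≤ (sumset T).card + 2 ∧ (2 * T.card + r ≤ (sumset T).card + 1 ∨
    (∃ k, 2 ≤ T.card ∧ T = (Finset.range T.card).image (Pi.single k)) ∨
    (∃ k l : Fin r, k ≠ l ∧ T = {0, Pi.single k 1, Pi.single l 1})) := by
  induction hm : T.card generalizing T with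
  | zero => simp [Finset.card_eq_zero.1 hm] at hT
  | succ m ih =>
    obtain ⟨b, hb, hmax⟩ := T.exists_max_image gradedLex hT
    set T' := T.erase b with hT'
    have hcT' : T'.card = m := by rw [hT', Finset.card_erase_of_mem hb, hm]; rfl
    have hins : T = insert b T' := (Finset.insert_erase hb).symm
    have hlt : ∀ c ∈ T', gradedLex c < gradedLex b := fun c hc =>
      lt_of_le_of_ne (hmax c (Finset.mem_of_mem_erase hc)) fun h =>
        Finset.ne_of_mem_erase hc (gradedLex_injective h)
    have hdeg : ∀ c ∈ T', ∑ k, c k ≤ ∑ k, b k := fun c hc => sum_le_of_gradedLex_le (hlt c hc).le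
    have hbT' : b ∉ T' := Finset.notMem_erase b T
    have sum_add : ∀ c c' : Fin r → ℕ, ∑ k, (c + c') k = ∑ k, c k + ∑ k, c' k := fun c c' => by
      simp [Finset.sum_add_distrib]
    -- the two top sums are new
    have hnew1 : 1 ≤ ∑ k, b k → b + b ∉ sumset T' := by
      intro hb1 h
      rcases mem_sumset_iff.1 h with ⟨c, hc, c', hc', h⟩ | ⟨k, h⟩
      · have := congrArg gradedLex h
        rw [gradedLex_add, gradedLex_add] at this
        exact absurd this (add_lt_add (hlt c hc) (hlt c' hc')).ne
      · have := congrArg (fun τ : Fin r → ℕ => ∑ k, τ k) h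
        simp only [sum_pi_single, sum_add] at this
        omega
    have hnew2 : ∀ b' ∈ T', (∀ c ∈ T', gradedLex c ≤ gradedLex b') →
        2 ≤ ∑ k, b k + ∑ k, b' k → b + b' ∉ sumset T' := by
      intro b' hb' hmax' hb1 h
      rcases mem_sumset_iff.1 h with ⟨c, hc, c', hc', h⟩ | ⟨k, h⟩
      · have := congrArg gradedLex h
        rw [gradedLex_add, gradedLex_add] at this
        exact absurd this (add_lt_add_of_lt_of_le (hlt c hc) (hmax' c' hc')).ne
      · have := congrArg (fun τ : Fin r → ℕ => ∑ k, τ k) h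
        simp only [sum_pi_single, sum_add] at this
        omega
    rcases T'.eq_empty_or_nonempty with hemp | hne
    -- A single exponent b contributes b + b, of even degree and so never a basis vector.
    · suffices 2 * (m + 1) + r ≤ (sumset T).card + 1 from ⟨by omega, Or.inl this⟩
      have hm0 : m = 0 := by rw [← hcT', hemp]; rfl
      have h1 : T = {b} := by rw [hins, hemp]; rfl
      have h2 : b + b ∉ Finset.univ.image fun k : Fin r => (Pi.single k 1 : Fin r → ℕ) := by
        intro h
        obtain ⟨k, -, h⟩ := Finset.mem_image.1 h
        have := congrArg (fun τ : Fin r → ℕ => ∑ k, τ k) h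
        simp only [sum_pi_single, sum_add] at this
        omega
      have h3 : sumset T = insert (b + b)
          (Finset.univ.image fun k : Fin r => (Pi.single k 1 : Fin r → ℕ)) := by
        rw [sumset, h1, Finset.singleton_add_singleton]; rfl
      rw [h3, Finset.card_insert_of_notMem h2, Finset.card_image_of_injective, Finset.card_fin]
      · omega
      · intro k l h
        by_contra hkl
        have := congrFun h k
        simp [hkl] at this
    obtain ⟨b', hb', hmax'⟩ := T'.exists_max_image gradedLex hne
    have hb0 : 1 ≤ ∑ k, b k := by
      by_contra h0
      have h1 : b = 0 := eq_zero_of_sum_eq_zero (by omega)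
      have h2 : b' = 0 := eq_zero_of_sum_eq_zero (by have := hdeg b' hb'; omega)
      exact hbT' (by rw [h1, ← h2]; exact hb')
    have gain2 : 2 ≤ ∑ k, b k + ∑ k, b' k → (sumset T').card + 2 ≤ (sumset T).card := by
      intro h
      have h1 := card_sumset_erase (G := {b, b'}) hb (by
        intro c hc
        rcases Finset.mem_insert.1 hc with rfl | hc
        · exact hb
        · rw [Finset.mem_singleton.1 hc]; exact Finset.mem_of_mem_erase hb') (by
        intro c hc
        rcases Finset.mem_insert.1 hc with rfl | hc
        · exact hnew1 hb0
        · rw [Finset.mem_singleton.1 hc]; exact hnew2 b' hb' hmax' h)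
      rwa [Finset.card_pair (fun h => hbT' (by rw [h]; exact hb'))] at h1
    have gain1 : (sumset T').card + 1 ≤ (sumset T).card :=
      card_sumset_erase (G := {b}) hb (by simpa using hb) (by simpa using hnew1 hb0)
    have gain3 : ∀ c₁ ∈ T', ∀ c₂ ∈ T', c₁ ≠ c₂ → b + c₁ ∉ sumset T' → b + c₂ ∉ sumset T' →
        (sumset T').card + 3 ≤ (sumset T).card := by
      intro c₁ h1 c₂ h2 h12 hn1 hn2
      have h3 := card_sumset_erase (G := {b, c₁, c₂}) hb (by
        intro c hc
        simp only [Finset.mem_insert, Finset.mem_singleton] at hc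
        rcases hc with rfl | rfl | rfl
        · exact hb
        · exact Finset.mem_of_mem_erase h1
        · exact Finset.mem_of_mem_erase h2) (by
        intro c hc
        simp only [Finset.mem_insert, Finset.mem_singleton] at hc
        rcases hc with rfl | rfl | rfl
        · exact hnew1 hb0
        · exact hn1
        · exact hn2)
      have h4 : ({b, c₁, c₂} : Finset (Fin r → ℕ)).card = 3 := by
        rw [Finset.card_eq_three]
        exact ⟨b, c₁, c₂, fun h => hbT' (h ▸ h1), fun h => hbT' (h ▸ h2), h12, rfl⟩
      rwa [h4] at h3
    have hdeg1 : ∀ c ∈ T', ∀ c' ∈ T', c ≠ c' → 1 ≤ ∑ k, b' k := by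
      intro c hc c' hc' hcc
      by_contra h0
      have h1 := sum_le_of_gradedLex_le (hmax' c hc)
      have h2 := sum_le_of_gradedLex_le (hmax' c' hc')
      exact hcc ((eq_zero_of_sum_eq_zero (by omega)).trans
        (eq_zero_of_sum_eq_zero (τ := c') (by omega)).symm)
    -- Adding the largest element b normally gains the two sums b + b and b + b'. The bound weakens
    -- by one only in passing from {0} to {0, e_k}, where b + b' is already a basis vector. From an
    -- exceptional set the gain is three, which restores the stronger bound, unless the enlarged set
    -- is again exceptional.
    obtain ⟨hcard, hbd | ⟨k, hm2, hE⟩ | ⟨k, l, hkl, hE⟩⟩ := ih T' hne hcT'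
    · refine ⟨by omega, ?_⟩
      by_cases h : 2 ≤ ∑ k, b k + ∑ k, b' k
      · left
        have := gain2 h
        omega
      · right; left
        have h1 : b' = 0 := eq_zero_of_sum_eq_zero (by omega)
        obtain ⟨k, hk⟩ := exists_eq_single_of_sum_eq_one (τ := b) (by omega)
        have h2 : T' = {0} := by
          apply Finset.eq_singleton_iff_unique_mem.2
          refine ⟨h1 ▸ hb', fun c hc => ?_⟩
          have := sum_le_of_gradedLex_le (hmax' c hc)
          exact eq_zero_of_sum_eq_zero (by omega)
        have hm1 : m = 1 := by rw [← hcT', h2]; rfl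
        refine ⟨k, by omega, ?_⟩
        rw [hins, h2, hk, hm1]
        ext c
        simp only [Finset.mem_insert, Finset.mem_singleton, Finset.mem_image, Finset.mem_range]
        constructor
        · rintro (rfl | rfl)
          · exact ⟨1, by omega, rfl⟩
          · exact ⟨0, by omega, by simp⟩
        · rintro ⟨a, ha, rfl⟩
          have : a = 0 ∨ a = 1 := by omega
          rcases this with rfl | rfl <;> simp
    · -- an initial segment of a coordinate line
      have memE : ∀ a < m, (Pi.single k a : Fin r → ℕ) ∈ T' := fun a ha => by
        rw [hE]; exact Finset.mem_image_of_mem _ (Finset.mem_range.2 ha)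
      have ofE : ∀ c ∈ T', ∃ a < m, c = Pi.single k a := fun c hc => by
        rw [hE] at hc
        obtain ⟨a, ha, rfl⟩ := Finset.mem_image.1 hc
        exact ⟨a, Finset.mem_range.1 ha, rfl⟩

      have hbm : m - 1 ≤ ∑ k, b k := by
        have := hdeg _ (memE (m - 1) (by omega))
        rwa [sum_pi_single] at this
      have h01 : (Pi.single k (m - 1) : Fin r → ℕ) ≠ Pi.single k (m - 2) := fun h => by
        have := congrFun h k
        simp at this
        omega
      have hg := gain2 (by
        have := hdeg1 _ (memE (m - 1) (by omega)) _ (memE (m - 2) (by omega)) h01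
        omega)
      refine ⟨by omega, ?_⟩
      by_cases hE1 : b = Pi.single k m
      · right; left
        refine ⟨k, by omega, ?_⟩
        rw [hins, hE, hE1, Finset.range_add_one, Finset.image_insert]
      by_cases hE2 : m = 2 ∧ ∃ l, b = Pi.single l 1
      · right; right
        obtain ⟨hm2, l, hl⟩ := hE2
        have hkl : k ≠ l := by
          rintro rfl
          exact hbT' (by rw [hl]; exact memE 1 (by omega))
        refine ⟨k, l, hkl, ?_⟩
        rw [hins, hE, hm2, hl]
        ext c
        simp only [Finset.mem_insert, Finset.mem_singleton, Finset.mem_image, Finset.mem_range]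
        constructor
        · rintro (rfl | ⟨a, ha, rfl⟩)
          · simp
          · have : a = 0 ∨ a = 1 := by omega
            rcases this with rfl | rfl <;> simp
        · rintro (rfl | rfl | rfl)
          · exact Or.inr ⟨0, by omega, by simp⟩
          · exact Or.inr ⟨1, by omega, rfl⟩
          · exact Or.inl rfl
      left
      have hb2 : 2 ≤ ∑ k, b k := by
        by_contra h
        have h1 : m = 2 := by omega
        exact hE2 ⟨h1, exists_eq_single_of_sum_eq_one (by omega)⟩
      -- If b lies off the axis, so does the sum. If b lies on it, its entry is at least m + 1, and
      -- adding a ≥ m - 2 exceeds the largest available sum 2m - 2.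
      have hnot : ∀ a, m - 2 ≤ a → a < m → b + Pi.single k a ∉ sumset T' := by
        intro a ha ham h
        rcases mem_sumset_iff.1 h with ⟨c, hc, c', hc', h⟩ | ⟨l, h⟩
        · obtain ⟨i, hi, rfl⟩ := ofE c hc
          obtain ⟨i', hi', rfl⟩ := ofE c' hc'
          have hbk : b = Pi.single k (b k) := by
            funext j
            by_cases hj : j = k
            · subst hj; simp
            · have := congrFun h j
              simp [hj] at this
              simp [hj, this]
          have hk1 : b k ≠ m := fun h => hE1 (by rw [← h]; exact hbk)
          have hk2 : ¬ b k < m := fun h => hbT' (by rw [hbk]; exact memE _ h)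
          have := congrFun h k
          simp at this
          omega
        · have := congrArg (fun τ : Fin r → ℕ => ∑ k, τ k) h
          simp only [sum_pi_single, sum_add] at this
          omega
      have := gain3 _ (memE (m - 1) (by omega)) _ (memE (m - 2) (by omega)) h01
        (hnot _ (by omega) (by omega)) (hnot _ (by omega) (by omega))
      omega
    · -- the origin and two basis vectors
      have hk : (Pi.single k 1 : Fin r → ℕ) ∈ T' := by rw [hE]; simp
      have hl : (Pi.single l 1 : Fin r → ℕ) ∈ T' := by rw [hE]; simp
      have hne : (Pi.single k 1 : Fin r → ℕ) ≠ Pi.single l 1 := fun h => by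
        have := congrFun h k
        simp [hkl] at this
      -- Either b has degree at least 2, so b + e_k and b + e_l have degree at least 3, or b is a
      -- third basis vector and its coordinate i is absent from the old sums.
      obtain ⟨i, hi⟩ : ∃ i, 3 ≤ ∑ k, b k + 1 ∨ (b i = 1 ∧ i ≠ k ∧ i ≠ l) := by
        by_cases h : 2 ≤ ∑ k, b k
        · exact ⟨k, Or.inl (by omega)⟩
        · obtain ⟨i, hi⟩ := exists_eq_single_of_sum_eq_one (τ := b) (by omega)
          refine ⟨i, Or.inr ⟨by rw [hi]; simp, ?_, ?_⟩⟩
          · rintro rfl; exact hbT' (hi ▸ hk)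
          · rintro rfl; exact hbT' (hi ▸ hl)
      have hT'deg : ∀ c ∈ T', ∑ k, c k ≤ 1 ∧ (i ≠ k → i ≠ l → c i = 0) := by
        intro c hc
        rw [hE] at hc
        simp only [Finset.mem_insert, Finset.mem_singleton] at hc
        rcases hc with rfl | rfl | rfl
        · simp
        · rw [sum_pi_single]; exact ⟨le_rfl, fun h _ => by simp [h]⟩
        · rw [sum_pi_single]; exact ⟨le_rfl, fun _ h => by simp [h]⟩
      have hnot : ∀ c₁ : Fin r → ℕ, ∑ k, c₁ k = 1 → b + c₁ ∉ sumset T' := by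
        intro c₁ h1 h
        rcases mem_sumset_iff.1 h with ⟨c, hc, c', hc', h⟩ | ⟨l, h⟩
        · rcases hi with hi | ⟨hi, hik, hil⟩
          · have := congrArg (fun τ : Fin r → ℕ => ∑ k, τ k) h
            simp only [sum_add] at this
            have := (hT'deg c hc).1
            have := (hT'deg c' hc').1
            omega
          · have := congrFun h i
            simp [(hT'deg c hc).2 hik hil, (hT'deg c' hc').2 hik hil] at this
            omega
        · have := congrArg (fun τ : Fin r → ℕ => ∑ k, τ k) h
          simp only [sum_pi_single, sum_add] at this
          omega
      have := gain3 _ hk _ hl hne (hnot _ (sum_pi_single _ _)) (hnot _ (sum_pi_single _ _))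
      exact ⟨by omega, Or.inl (by omega)⟩

end Multisymmetric

/-! ### Excluding full support in all cases -/

namespace Multisymmetric

open Matrix MvPolynomial

/-- The graded lexicographic order is linear and compatible with addition, so the Cauchy-Davenport
bound for ordered monoids applies. It supplies the n exponents in T + T for the Gram matrix. -/
theorem card_add_self {r : ℕ} {T : Finset (Fin r → ℕ)} (hT : T.Nonempty) :
    2 * T.card ≤ (T + T).card + 1 := by
  have h := cauchy_davenport_add_of_linearOrder_isCancelAdd (s := T.image gradedLex)
    (t := T.image gradedLex) (hT.image _) (hT.image _)
  let φ : (Fin r → ℕ) →ₙ+ DegLex (Fin r →₀ ℕ) := ⟨gradedLex, gradedLex_add⟩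
  have h1 : T.image gradedLex + T.image gradedLex = (T + T).image gradedLex :=
    (Finset.image_add φ).symm
  rw [h1, Finset.card_image_of_injective _ gradedLex_injective,
    Finset.card_image_of_injective _ gradedLex_injective] at h
  omega

theorem det_mon_ne_zero {n r : ℕ} {Ω : Type*} [Field Ω] [Algebra ℚ Ω] {p : Fin n → Fin r → Ω}
    (hp : Function.Injective (aeval (fun ik : Fin n × Fin r => p ik.1 ik.2) :
      MvPolynomial (Fin n × Fin r) ℚ →ₐ[ℚ] Ω)) {e : Fin n → Fin r → ℕ}
    (he : Function.Injective e) : (Matrix.of fun i b => mon (e b) (p i)).det ≠ 0 := by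
  have := aeval_det_genericMatrix e id p
  simp only [id] at this
  rw [← this]
  intro h
  exact det_genericMatrix_ne_zero he Function.injective_id ((map_eq_zero_iff _ hp).1 h)

/-- Generic rows cannot be mixed by an orthogonal matrix without zero entries that is compatible
with the monomials in `sumset T`. -/
theorem false_of_full_support_of_sumset {n r : ℕ} (hn : 2 < n) {T : Finset (Fin r → ℕ)}
    (hT : n + 1 = 2 * T.card) {Ω : Type*} [Field Ω] [Algebra ℚ Ω]
    {p : Fin n → Fin r → Ω}
    (hp : Function.Injective (aeval (fun ik : Fin n × Fin r => p ik.1 ik.2) :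
      MvPolynomial (Fin n × Fin r) ℚ →ₐ[ℚ] Ω))
    {D : Fin n → Fin r → Derivation ℚ Ω Ω}
    (hD : ∀ i k i' k', D i k (p i' k') = if i' = i ∧ k' = k then 1 else 0)
    {Z : Matrix (Fin n) (Fin n) Ω} (hZ : Z * Zᵀ = 1) (hfull : ∀ j i, Z j i ≠ 0)
    {q : Fin n → Fin r → Ω}
    (hq : ∀ τ ∈ sumset T, ∀ j, mon τ (q j) = ∑ i, Z j i * mon τ (p i)) : False := by
  have hne : T.Nonempty := Finset.card_pos.1 (by omega)
  obtain ⟨-, hc | ⟨k, h2, hE⟩ | ⟨k, l, hkl, hE⟩⟩ := card_sumset T hne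
  · have hinj : Function.Injective fun k : Fin r => (Pi.single k 1 : Fin r → ℕ) := by
      intro k l h
      by_contra hkl
      have := congrFun h k
      simp [hkl] at this
    set E := Finset.univ.image fun k : Fin r => (Pi.single k 1 : Fin r → ℕ) with hEdef
    have hcE : E.card = r := by rw [hEdef, Finset.card_image_of_injective _ hinj, Finset.card_fin]
    -- Here 2|T| = n + 1, so at least n + r exponents are available, r of them being the basis
    -- vectors.
    have h3 : n ≤ (sumset T \ E).card := by
      have := Finset.le_card_sdiff E (sumset T)
      omega
    obtain ⟨G, hG, hGc⟩ := Finset.exists_subset_card_eq h3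
    let g : Fin n ≃ G := (finCongr hGc.symm).trans G.equivFin.symm
    have hg : ∀ i, (g i : Fin r → ℕ) ∈ sumset T ∧ (g i : Fin r → ℕ) ∉ E := fun i =>
      Finset.mem_sdiff.1 (hG (g i).2)
    refine false_of_full_support hp hD hZ hfull (q := q)
      (e := Sum.elim (fun i => (g i : Fin r → ℕ)) fun k => Pi.single k 1) ?_ (fun k => rfl) ?_
      (by omega)
    · refine Function.Injective.sumElim (Subtype.val_injective.comp g.injective) hinj ?_
      intro i k h
      exact (hg i).2 (Finset.mem_image.2 ⟨k, Finset.mem_univ k, h.symm⟩)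
    · rintro (i | k) j
      · exact hq _ (hg i).1 j
      · exact hq _ (single_mem_sumset T k) j
  · refine false_of_full_support_of_line hZ hfull (by omega) (k := k) (x := p) (y := q)
      (det_mon_ne_zero hp (e := fun b : Fin n => Pi.single k (b : ℕ)) ?_) ?_
    · intro a b h
      have := congrFun h k
      simp at this
      exact Fin.ext this
    · intro a ha j
      apply hq
      have mem : ∀ c < T.card, (Pi.single k c : Fin r → ℕ) ∈ T := fun c hc => by
        rw [hE]; exact Finset.mem_image_of_mem _ (Finset.mem_range.2 hc)
      have h3 := add_mem_sumset (mem (min a (T.card - 1)) (by omega))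
        (mem (a - min a (T.card - 1)) (by omega))
      have h4 : min a (T.card - 1) + (a - min a (T.card - 1)) = a := by omega
      rwa [← Pi.single_add, h4] at h3
  · have hne1 : (Pi.single k 1 : Fin r → ℕ) ≠ Pi.single l 1 := fun h => by
      have := congrFun h k
      simp [hkl] at this
    have hcard : T.card ≤ 3 := by rw [hE]; exact Finset.card_le_three
    have hcard' : T.card = 3 := by
      rw [hE]
      refine Finset.card_eq_three.2 ⟨_, _, _, ?_, ?_, hne1, rfl⟩
      · intro h; have := congrFun h k; simp at this
      · intro h; have := congrFun h l; simp at this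
    obtain rfl : n = 5 := by omega
    have m0 : (0 : Fin r → ℕ) ∈ T := by rw [hE]; simp
    have mk : (Pi.single k 1 : Fin r → ℕ) ∈ T := by rw [hE]; simp
    have ml : (Pi.single l 1 : Fin r → ℕ) ∈ T := by rw [hE]; simp
    -- Five of the six monomials of degree at most two suffice for an invertible matrix on five
    -- generic points.
    let B : Fin 5 → Fin r → ℕ := ![0, Pi.single k 1, Pi.single l 1,
      Pi.single k 1 + Pi.single k 1, Pi.single k 1 + Pi.single l 1]
    have hB : Function.Injective B := by
      have hval : ∀ b, (B b k, B b l) = (![(0, 0), (1, 0), (0, 1), (2, 0), (1, 1)] : Fin 5 → ℕ × ℕ) b := by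
        intro b
        fin_cases b <;> simp [B, hkl, hkl.symm]
      have hinj : Function.Injective (![(0, 0), (1, 0), (0, 1), (2, 0), (1, 1)] : Fin 5 → ℕ × ℕ) := by
        decide
      intro b b' h
      apply hinj
      rw [← hval, ← hval, h]
    have hdet := det_mon_ne_zero hp hB
    have q0 := hq _ (add_mem_sumset m0 m0)
    have qk := hq _ (add_mem_sumset m0 mk)
    have ql := hq _ (add_mem_sumset m0 ml)
    have qkk := hq _ (add_mem_sumset mk mk)
    have qkl := hq _ (add_mem_sumset mk ml)
    have qll := hq _ (add_mem_sumset ml ml)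
    have hqB : ∀ b j, mon (B b) (q j) = ∑ i, Z j i * mon (B b) (p i) := by
      intro b j
      fin_cases b
      · simpa [B] using q0 j
      · simpa [B] using qk j
      · simpa [B] using ql j
      · exact qkk j
      · exact qkl j
    have hmonB : ∀ (x y : Fin r → Ω), x k = y k → x l = y l → ∀ b, mon (B b) x = mon (B b) y := by
      intro x y h1 h2 b
      fin_cases b
      · simp [B]
      · simp [B, h1]
      · simp [B, h2]
      · simp [B, mon_add, h1]
      · simp [B, mon_add, h1, h2]
    refine false_of_plane_quintuple (u := fun i => p i k) (w := fun i => p i l)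
      (u' := fun i => q i k) (w' := fun i => q i l) (Du := fun i => D i k) (Dw := fun i => D i l)
      ?_ ?_ ?_ ?_ hZ ?_ ?_ ?_ ?_ ?_ ?_ ?_ ?_
    · intro i j; simp [hD]
    · intro i j; simp [hD, hkl.symm]
    · intro i j; simp [hD, hkl]
    · intro i j; simp [hD]
    · intro j; simpa using q0 j
    · intro j; simpa using qk j
    · intro j; simpa using ql j
    · intro j; simpa [mon_add] using qkk j
    · intro j; simpa [mon_add] using qkl j
    · intro j; simpa [mon_add] using qll j
    · intro i j
      by_contra! h
      have h1 := row_eq_single (B := B) hdet (z := Z j) (i₀ := i) fun b => by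
        rw [← hqB]
        exact hmonB _ _ (sub_eq_zero.1 h.1) (sub_eq_zero.1 h.2) b
      obtain ⟨i', hi'⟩ := exists_ne i
      exact hfull j i' (by rw [h1]; simp [hi'])
    -- If the images of points 0 and 1 coincided, rows 0 and 1 of Z would be equal, contradicting
    -- orthogonality.
    · by_contra! h
      have hu : IsUnit (Matrix.of fun i b => mon (B b) (p i)) := by
        rw [Matrix.isUnit_iff_isUnit_det]; exact isUnit_iff_ne_zero.2 hdet
      have h1 : Z 1 = Z 0 := by
        apply Matrix.vecMul_injective_of_isUnit hu
        ext b
        have h2 := hmonB _ _ (sub_eq_zero.1 h.1) (sub_eq_zero.1 h.2) b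
        rw [hqB, hqB] at h2
        simpa [Matrix.vecMul, dotProduct] using h2
      have h3 := congrFun (congrFun hZ 1) 0
      have h4 := congrFun (congrFun hZ 0) 0
      rw [Matrix.mul_apply] at h3 h4
      rw [h1, h4] at h3
      simp at h3

end Multisymmetric

/-! ### A polynomial certifying rigidity -/

namespace Multisymmetric

open Matrix MvPolynomial

/-- Generic rows admit no mixing matrix without zero entries. -/
theorem exists_generic_not_full_support {n r : ℕ} (hn : 2 < n) {T : Finset (Fin r → ℕ)}
    (hT : n + 1 = 2 * T.card) : ∃ P : MvPolynomial (Fin n × Fin r) ℚ, P ≠ 0 ∧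
      ∀ {F : Type*} [Field F] [Algebra ℚ F] (x y : Fin n → Fin r → F)
        (Z : Matrix (Fin n) (Fin n) F), Z * Zᵀ = 1 → (∀ j i, Z j i ≠ 0) →
        (∀ τ ∈ sumset T, ∀ j, mon τ (y j) = ∑ i, Z j i * mon τ (x i)) →
        aeval (fun ik : Fin n × Fin r => x ik.1 ik.2) P = 0 := by
  let A := MvPolynomial (Fin n × Fin r) ℚ
  -- The additional variable is an inverse of the product of all entries of Z, expressing full
  -- support as an equation.
  let V := (Fin n × Fin n) ⊕ Unit
  let z : Fin n → Fin n → MvPolynomial V A := fun j i => X (Sum.inl (j, i))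
  -- The basis vectors belong to `sumset T`, so y is determined by Z and x and needs no unknowns of
  -- its own.
  let q : Fin n → Fin r → MvPolynomial V A := fun j k => ∑ i, z j i * C (X (i, k))
  let sys : Set (MvPolynomial V A) :=
    (Set.range fun jj : Fin n × Fin n =>
      ∑ i, z jj.1 i * z jj.2 i - if jj.1 = jj.2 then 1 else 0) ∪
    (Set.range fun τj : sumset T × Fin n =>
      mon τj.1.1 (q τj.2) - ∑ i, z τj.2 i * C (mon τj.1.1 (genericRow i))) ∪
    {X (Sum.inr ()) * ∏ j, ∏ i, z j i - 1}
  obtain ⟨P, hP, h⟩ := exists_resultant sys (by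
    intro Ω _ _ p hp D hD v hv
    have hv' : ∀ f ∈ sys, eval₂Hom (aeval p : A →ₐ[ℚ] Ω).toRingHom v f = 0 := hv
    refine false_of_full_support_of_sumset hn hT (p := fun i k => p (i, k)) hp
      (D := fun i k => D (i, k)) (fun i k i' k' => by rw [hD]; simp)
      (Z := Matrix.of fun j i => v (Sum.inl (j, i))) ?_ ?_
      (q := fun j k => ∑ i, v (Sum.inl (j, i)) * p (i, k)) ?_
    · ext j j'
      have := hv' _ (Or.inl (Or.inl ⟨(j, j'), rfl⟩))
      simp only [map_sub, map_sum, map_mul, z, eval₂Hom_X', sub_eq_zero] at this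
      rw [Matrix.mul_apply]
      simp only [Matrix.of_apply, Matrix.transpose_apply, Matrix.one_apply]
      rw [this]
      split_ifs <;> simp
    · intro j i h0
      have := hv' _ (Or.inr rfl)
      simp only [map_sub, map_mul, map_prod, z, eval₂Hom_X', map_one, sub_eq_zero] at this
      rw [Finset.prod_eq_zero (Finset.mem_univ j)
        (Finset.prod_eq_zero (Finset.mem_univ i) h0), mul_zero] at this
      exact zero_ne_one this
    · intro τ hτ j
      have := hv' _ (Or.inl (Or.inr ⟨(⟨τ, hτ⟩, j), rfl⟩))
      simp only [map_sub, map_mon, map_sum, map_mul, z, q, eval₂Hom_X', eval₂Hom_C,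
        sub_eq_zero, genericRow] at this
      simpa using this)
  refine ⟨P, hP, fun {F} _ _ x y Z hZ hfull hZy => ?_⟩
  refine h _ (Sum.elim (fun ji => Z ji.1 ji.2) fun _ => (∏ j, ∏ i, Z j i)⁻¹) fun f hf => ?_
  change eval₂Hom _ _ f = 0
  rcases hf with (⟨⟨j, j'⟩, rfl⟩ | ⟨⟨⟨τ, hτ⟩, j⟩, rfl⟩) | hf
  · have := congrFun (congrFun hZ j) j'
    rw [Matrix.mul_apply] at this
    simp only [Matrix.transpose_apply, Matrix.one_apply] at this
    simp only [map_sub, map_sum, map_mul, z, eval₂Hom_X', Sum.elim_inl, this]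
    split_ifs <;> simp
  · have hy : y j = fun k => ∑ i, Z j i * x i k := by
      funext k
      have := hZy _ (single_mem_sumset T k) j
      simpa using this
    have := hZy τ hτ j
    rw [hy] at this
    simp only [map_sub, map_mon, map_sum, map_mul, z, q, eval₂Hom_X', eval₂Hom_C, genericRow,
      Sum.elim_inl]
    simp [this]
  · rw [Set.mem_singleton_iff.1 hf]
    simp only [map_sub, map_mul, map_prod, z, eval₂Hom_X', map_one, Sum.elim_inl, Sum.elim_inr]
    rw [inv_mul_cancel₀, sub_self]
    exact Finset.prod_ne_zero_iff.2 fun j _ => Finset.prod_ne_zero_iff.2 fun i _ => hfull j i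

/-- A generic family of rows is determined up to a permutation by its moments. -/
theorem exists_generic_determined {n r : ℕ} (hn : 2 < n) {T : Finset (Fin r → ℕ)}
    (hT : T.card = n / 2 + 1) : ∃ P : MvPolynomial (Fin n × Fin r) ℚ, P ≠ 0 ∧
      ∀ {F : Type*} [Field F] [Algebra ℚ F] (x y : Fin n → Fin r → F),
        aeval (fun ik : Fin n × Fin r => x ik.1 ik.2) P ≠ 0 →
        (∀ τ ∈ T + T, ∀ τ' ∈ sumset T,
          ∑ i, mon (τ + τ') (x i) = ∑ i, mon (τ + τ') (y i)) →
        ∃ π : Equiv.Perm (Fin n), ∀ j, y j = x (π j) := by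
  classical
  have hne : T.Nonempty := Finset.card_pos.1 (by omega)
  -- Full support is possible only when n + 1 = 2|T|, that is for odd n; otherwise the constant 1
  -- serves.
  obtain ⟨P₀, hP₀, h₀⟩ : ∃ P : MvPolynomial (Fin n × Fin r) ℚ, P ≠ 0 ∧
      ∀ {F : Type _} [Field F] [Algebra ℚ F] (x y : Fin n → Fin r → F)
        (Z : Matrix (Fin n) (Fin n) F), n + 1 = 2 * T.card → Z * Zᵀ = 1 → (∀ j i, Z j i ≠ 0) →
        (∀ τ ∈ sumset T, ∀ j, mon τ (y j) = ∑ i, Z j i * mon τ (x i)) →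
        aeval (fun ik : Fin n × Fin r => x ik.1 ik.2) P = 0 := by
    by_cases h : n + 1 = 2 * T.card
    · obtain ⟨P, hP, hP'⟩ := exists_generic_not_full_support hn h
      exact ⟨P, hP, fun x y Z _ => hP' x y Z⟩
    · exact ⟨1, one_ne_zero, fun x y Z h' => absurd h' h⟩
  have hcard : n ≤ (T + T).card := by have := card_add_self hne; omega
  obtain ⟨G, hG, hGc⟩ := Finset.exists_subset_card_eq hcard
  let g : Fin n ≃ G := (finCongr hGc.symm).trans G.equivFin.symm
  let B : Fin n → Fin r → ℕ := fun i => g i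
  have hB : Function.Injective B := Subtype.val_injective.comp g.injective
  have hBm : ∀ i, B i ∈ T + T := fun i => hG (g i).2
  -- The factors ensure, in order: nonzero coordinates for the sign argument, general position of
  -- the vectors of T-monomials, invertibility of the Gram basis, and absence of a mixing matrix
  -- without zeros.
  refine ⟨(∏ ik : Fin n × Fin r, X ik) * (∏ J : T ↪ Fin n, (genericMatrix (fun b : T => b.1) J).det) *
    (genericMatrix B id).det * P₀, ?_, fun {F} _ _ x y hx hm => ?_⟩
  · refine mul_ne_zero (mul_ne_zero (mul_ne_zero ?_ ?_) ?_) hP₀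
    · exact Finset.prod_ne_zero_iff.2 fun ik _ => X_ne_zero ik
    · exact Finset.prod_ne_zero_iff.2 fun J _ =>
        det_genericMatrix_ne_zero Subtype.val_injective J.injective
    · exact det_genericMatrix_ne_zero hB Function.injective_id
  · simp only [map_mul, map_prod, mul_ne_zero_iff, Finset.prod_ne_zero_iff, aeval_X,
      aeval_det_genericMatrix] at hx
    obtain ⟨⟨⟨h1, h2⟩, h3⟩, h4⟩ := hx
    rcases perm_or_full_support hne (by omega) (by omega) (fun i k => h1 (i, k) (Finset.mem_univ _))
      (fun J hJ => h2 ⟨J, hJ⟩ (Finset.mem_univ _)) hBm h3 hm with h | ⟨hodd, Z, hZ, hZy, hfull⟩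
    · exact h
    · exact absurd (h₀ x y Z hodd hZ hfull hZy) h4

end Multisymmetric

/-! ### Packing and covering estimates -/

namespace Multisymmetric

open MeasureTheory Module Metric
open scoped ENNReal Pointwise

/-- The volume bound for a separated set in a ball. -/
theorem card_mul_pow_le_of_separated {E : Type*} [NormedAddCommGroup E] [NormedSpace ℝ E]
    [FiniteDimensional ℝ E] (s : Finset E) {R δ : ℝ} (hδ : 0 < δ) (hR : 0 ≤ R)
    (hs : ∀ c ∈ s, ‖c‖ ≤ R) (h : ∀ c ∈ s, ∀ d ∈ s, c ≠ d → δ ≤ ‖c - d‖) :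
    s.card * δ ^ finrank ℝ E ≤ (2 * R + δ) ^ finrank ℝ E := by
  borelize E
  let μ : Measure E := Measure.addHaar
  have hρ : 0 < R + δ / 2 := by positivity
  have hδ2 : 0 < δ / 2 := by positivity
  set A := ⋃ c ∈ s, ball (c : E) (δ / 2) with hA
  have D : Set.Pairwise (s : Set E) (Function.onFun Disjoint fun c => ball (c : E) (δ / 2)) := by
    rintro c hc d hd hcd
    apply ball_disjoint_ball
    rw [dist_eq_norm]
    linarith [h c hc d hd hcd]
  have A_subset : A ⊆ ball (0 : E) (R + δ / 2) := by
    refine Set.iUnion₂_subset fun x hx => ?_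
    apply ball_subset_ball'
    rw [dist_zero_right]
    linarith [hs x hx]
  have I : (s.card : ℝ≥0∞) * ENNReal.ofReal ((δ / 2) ^ finrank ℝ E) * μ (ball 0 1) ≤
      ENNReal.ofReal ((R + δ / 2) ^ finrank ℝ E) * μ (ball 0 1) :=
    calc
      (s.card : ℝ≥0∞) * ENNReal.ofReal ((δ / 2) ^ finrank ℝ E) * μ (ball 0 1) = μ A := by
        rw [hA, measure_biUnion_finset D fun c _ => measurableSet_ball]
        simp only [μ.addHaar_ball_of_pos _ hδ2]
        simp only [Finset.sum_const, nsmul_eq_mul, mul_assoc]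
      _ ≤ μ (ball (0 : E) (R + δ / 2)) := measure_mono A_subset
      _ = ENNReal.ofReal ((R + δ / 2) ^ finrank ℝ E) * μ (ball 0 1) := by
        simp only [μ.addHaar_ball_of_pos _ hρ]
  have J : (s.card : ℝ≥0∞) * ENNReal.ofReal ((δ / 2) ^ finrank ℝ E) ≤
      ENNReal.ofReal ((R + δ / 2) ^ finrank ℝ E) :=
    (ENNReal.mul_le_mul_iff_left (measure_ball_pos _ _ zero_lt_one).ne'
      measure_ball_lt_top.ne).1 I
  have K := ENNReal.toReal_le_of_le_ofReal (pow_nonneg hρ.le _) J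
  rw [ENNReal.toReal_mul, ENNReal.toReal_natCast, ENNReal.toReal_ofReal (by positivity)] at K
  have h2 : (0 : ℝ) < 2 ^ finrank ℝ E := by positivity
  calc s.card * δ ^ finrank ℝ E
      = 2 ^ finrank ℝ E * (s.card * (δ / 2) ^ finrank ℝ E) := by
        rw [div_pow]; field_simp
    _ ≤ 2 ^ finrank ℝ E * (R + δ / 2) ^ finrank ℝ E := mul_le_mul_of_nonneg_left K h2.le
    _ = (2 * R + δ) ^ finrank ℝ E := by rw [← mul_pow]; congr 1; ring

/-- Comparison of the numbers of elements of two sizes in an additive group mapped to a normed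
space, when the larger elements lie in a subspace. -/
theorem ncard_mul_pow_le {G E : Type*} [AddCommGroup G] [NormedAddCommGroup E] [NormedSpace ℝ E]
    (ψ : G →+ E) (W : Submodule ℝ E) [FiniteDimensional ℝ W] {A : Set G} (hA : A.Finite)
    {R δ : ℝ} (hδ : 0 < δ) (hR : 0 ≤ R) (hAW : ∀ x ∈ A, ψ x ∈ W) (hAR : ∀ x ∈ A, ‖ψ x‖ ≤ R)
    (hB : {x | ‖ψ x‖ < δ}.Finite) :
    A.ncard * δ ^ finrank ℝ W ≤ (2 * R + δ) ^ finrank ℝ W * {x | ‖ψ x‖ < δ}.ncard := by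
  classical
  lift A to Finset G using hA
  obtain ⟨B, hBe⟩ := hB.exists_finset_coe
  rw [← hBe, Set.ncard_coe_finset, Set.ncard_coe_finset]
  have hBm : ∀ x, x ∈ B ↔ ‖ψ x‖ < δ := fun x => by
    rw [← Finset.mem_coe, hBe]; rfl
  let sep : Finset G → Prop := fun Y => ∀ c ∈ Y, ∀ d ∈ Y, c ≠ d → δ ≤ ‖ψ (c - d)‖
  -- By maximality of the separated set Y, every element of A is an element of Y plus an element of
  -- B. The volume bound in W controls the size of Y.
  obtain ⟨Y, hY, hYmax⟩ := (A.powerset.filter sep).exists_max_image Finset.card ⟨∅, by simp [sep]⟩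
  rw [Finset.mem_filter, Finset.mem_powerset] at hY
  have hcov : ∀ a ∈ A, ∃ y ∈ Y, a - y ∈ B := by
    intro a ha
    by_cases haY : a ∈ Y
    · exact ⟨a, haY, by rw [hBm]; simpa using hδ⟩
    by_contra! hno
    have h1 := hYmax (insert a Y) (by
      rw [Finset.mem_filter, Finset.mem_powerset]
      refine ⟨Finset.insert_subset (by exact_mod_cast ha) hY.1, ?_⟩
      intro c hc d hd hcd
      rcases Finset.mem_insert.1 hc with hca | hc <;>
        rcases Finset.mem_insert.1 hd with hda | hd
      · exact absurd (hca.trans hda.symm) hcd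
      · have := hno d hd
        rw [hBm] at this
        rw [hca]
        exact not_lt.1 this
      · have := hno c hc
        rw [hda]
        rw [hBm] at this
        rw [← neg_sub, map_neg, norm_neg]
        exact not_lt.1 this
      · exact hY.2 c hc d hd hcd)
    rw [Finset.card_insert_of_notMem haY] at h1
    omega
  choose! y hyY hyB using hcov
  have hcard : A.card ≤ Y.card * B.card := by
    rw [← Finset.card_product]
    refine Finset.card_le_card_of_injOn (fun a => (y a, a - y a)) ?_ ?_
    · intro a ha
      exact Finset.mem_coe.2 (Finset.mem_product.2 ⟨hyY a ha, hyB a ha⟩)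
    · intro a _ a' _ h
      have h1 := congrArg Prod.fst h
      have h2 := congrArg Prod.snd h
      simp only at h1 h2
      rw [h1] at h2
      exact sub_left_injective h2
  have hYinj : Set.InjOn ψ Y := by
    intro c hc d hd hcd
    by_contra hne
    have := hY.2 c hc d hd hne
    rw [map_sub, hcd, sub_self, norm_zero] at this
    linarith
  have hWY : ∀ c ∈ Y, ψ c ∈ W := fun c hc => hAW c (hY.1 hc)
  let s : Finset W := Finset.image (fun c : Y => (⟨ψ c.1, hWY c.1 c.2⟩ : W)) Y.attach
  have hs : s.card = Y.card := by
    rw [Finset.card_image_of_injOn, Finset.card_attach]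
    intro c _ d _ h
    exact Subtype.ext (hYinj c.2 d.2 (congrArg Subtype.val h))
  have hpack := card_mul_pow_le_of_separated s hδ hR (by
    intro c hc
    obtain ⟨a, -, rfl⟩ := Finset.mem_image.1 hc
    exact hAR a (hY.1 a.2)) (by
    intro c hc d hd hcd
    obtain ⟨a, -, rfl⟩ := Finset.mem_image.1 hc
    obtain ⟨b, -, rfl⟩ := Finset.mem_image.1 hd
    have := hY.2 a a.2 b b.2 (fun h => hcd (by simp [h]))
    rw [map_sub] at this
    exact this)
  rw [hs] at hpack
  have h3 : (A.card : ℝ) ≤ Y.card * B.card := by exact_mod_cast hcard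
  calc (A.card : ℝ) * δ ^ finrank ℝ W ≤ (Y.card * B.card) * δ ^ finrank ℝ W := by gcongr
    _ = (Y.card * δ ^ finrank ℝ W) * B.card := by ring
    _ ≤ _ := by gcongr

/-- If every point is covered at most `M` times by the translates of `s`, then the measure of `s`
is at most `M` times that of a fundamental domain. -/
theorem measure_le_mul_of_multiplicity {G E : Type*} [MeasurableSpace E] {μ : Measure E}
    {D s : Set E} [AddGroup G] [Countable G] [AddAction G E] [MeasurableSpace G]
    [MeasurableVAdd G E] [VAddInvariantMeasure G E μ]
    (fund : IsAddFundamentalDomain G D μ) (hs : MeasurableSet s) (M : ℕ)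
    (hM : ∀ x, {g : G | x ∈ g +ᵥ s}.encard ≤ M) : μ s ≤ M * μ D := by
  have hm : ∀ g : G, MeasurableSet (g +ᵥ s) := fun g => hs.const_vadd g
  rw [fund.measure_eq_tsum s]
  calc ∑' g : G, μ ((g +ᵥ s) ∩ D)
      = ∑' g : G, ∫⁻ x in D, (g +ᵥ s).indicator 1 x ∂μ := by
        refine tsum_congr fun g => ?_
        rw [lintegral_indicator_one (hm g), Measure.restrict_apply (hm g)]
    _ = ∫⁻ x in D, ∑' g : G, (g +ᵥ s).indicator 1 x ∂μ :=
        (lintegral_tsum fun g => (measurable_one.indicator (hm g)).aemeasurable).symm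
    _ ≤ ∫⁻ _ in D, (M : ℝ≥0∞) ∂μ := by
        refine lintegral_mono fun x => ?_
        have h1 : ∀ g : G, (g +ᵥ s).indicator (1 : E → ℝ≥0∞) x =
            {g : G | x ∈ g +ᵥ s}.indicator (fun _ => 1) g := fun g => by
          classical
          rw [Set.indicator_apply, Set.indicator_apply]
          rfl
        rw [tsum_congr h1, ← tsum_subtype]
        change ∑' _ : {g : G | x ∈ g +ᵥ s}, (1 : ℝ≥0∞) ≤ M
        rw [ENNReal.tsum_set_one]
        exact_mod_cast hM x
    _ = M * μ D := by rw [lintegral_const, Measure.restrict_apply_univ]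

end Multisymmetric

/-! ### Counting small algebraic integers -/

namespace Multisymmetric

open MeasureTheory Module NumberField NumberField.mixedEmbedding NumberField.InfinitePlace
open scoped ENNReal Pointwise NNReal

/-- The algebraic integers all of whose conjugates are smaller than `R`. -/
def smallIntegers (L : Type*) [Field L] [NumberField L] (R : ℝ) : Set (𝓞 L) :=
  {x | house (x : L) < R}

theorem house_lt_of_forall {L : Type*} [Field L] [NumberField L] {R : ℝ} (hR : 0 < R) {x : L}
    (h : ∀ w : InfinitePlace L, w x < R) : house x < R := by
  rw [house, pi_norm_lt_iff hR]
  intro φ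
  have := h (InfinitePlace.mk φ)
  rwa [InfinitePlace.apply] at this

theorem finite_house_le (L : Type*) [Field L] [NumberField L] (R : ℝ) :
    {x : 𝓞 L | house (x : L) ≤ R}.Finite := by
  refine Set.Finite.of_finite_image ((Embeddings.finite_of_norm_le L ℂ R).subset ?_)
    (RingOfIntegers.coe_injective (K := L)).injOn
  rintro _ ⟨x, hx, rfl⟩
  exact ⟨x.2, fun φ => (norm_embedding_le_house _ φ).trans hx⟩

theorem finite_smallIntegers (L : Type*) [Field L] [NumberField L] (R : ℝ) :
    (smallIntegers L R).Finite :=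
  (finite_house_le L R).subset fun _ (hx : _ < R) => hx.le

/-- A lower bound for the number of small algebraic integers. -/
theorem pow_le_ncard_smallIntegers (L : Type*) [Field L] [NumberField L] {R : ℝ} (hR : 0 < R) :
    R ^ finrank ℚ L ≤ (smallIntegers L R).ncard * Real.sqrt |(discr L : ℝ)| := by
  classical
  -- With radius R/2, lattice vectors whose translated boxes share a point differ by an integer of
  -- house less than R, which bounds the covering multiplicity.
  set f : InfinitePlace L → ℝ≥0 := fun _ => Real.toNNReal (R / 2) with hf
  have hmeas : MeasurableSet (convexBodyLT L f) :=
    (MeasurableSet.univ_pi fun _ => Metric.isOpen_ball.measurableSet).prod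
      (MeasurableSet.univ_pi fun _ => Metric.isOpen_ball.measurableSet)
  have hmult : ∀ x : mixedSpace L,
      {g : (Submodule.span ℤ (Set.range (latticeBasis L))).toAddSubgroup |
        x ∈ g +ᵥ convexBodyLT L f}.encard ≤ (smallIntegers L R).ncard := by
    intro x
    rw [(finite_smallIntegers L R).cast_ncard_eq]
    have hlift : ∀ g : (Submodule.span ℤ (Set.range (latticeBasis L))).toAddSubgroup,
        ∃ a : 𝓞 L, mixedEmbedding L a = g := fun g => by
      obtain ⟨a, ha⟩ := (mem_span_latticeBasis L).1 g.2
      exact ⟨a, ha⟩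
    choose a ha using hlift
    rcases Set.eq_empty_or_nonempty {g : (Submodule.span ℤ (Set.range (latticeBasis L))).toAddSubgroup |
        x ∈ g +ᵥ convexBodyLT L f} with he | ⟨g₀, hg₀⟩
    · rw [he]; simp
    refine Set.encard_le_encard_of_injOn (f := fun g => a g - a g₀) ?_ ?_
    · intro g hg
      refine house_lt_of_forall hR ?_
      obtain ⟨u, hu, hux⟩ := hg
      obtain ⟨v, hv, hvx⟩ := hg₀
      have h1 : mixedEmbedding L ((a g - a g₀ : 𝓞 L) : L) = v - u := by
        have h2 : (g : mixedSpace L) + u = x := hux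
        have h3 : (g₀ : mixedSpace L) + v = x := hvx
        push_cast
        rw [map_sub, ha, ha, sub_eq_sub_iff_add_eq_add, add_comm v, h2, h3]
      have h4 : mixedEmbedding L ((a g - a g₀ : 𝓞 L) : L) ∈
          convexBodyLT L (fun _ => Real.toNNReal R) := by
        rw [h1]
        simp only [Set.mem_prod, Set.mem_pi, Set.mem_univ, mem_ball_zero_iff, forall_const,
          hf, Real.coe_toNNReal _ hR.le, Real.coe_toNNReal _ (half_pos hR).le] at hu hv ⊢
        refine ⟨fun w => ?_, fun w => ?_⟩
        · have := norm_sub_le (v.1 w) (u.1 w)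
          have h5 := hu.1 w
          have h6 := hv.1 w
          rw [Prod.fst_sub, Pi.sub_apply]
          linarith
        · have := norm_sub_le (v.2 w) (u.2 w)
          have h5 := hu.2 w
          have h6 := hv.2 w
          rw [Prod.snd_sub, Pi.sub_apply]
          linarith
      intro w
      have := (convexBodyLT_mem L _).1 h4 w
      rwa [Real.coe_toNNReal _ hR.le] at this
    · intro g _ g' _ h
      have h1 : a g = a g' := sub_left_injective h
      exact Subtype.ext (by rw [← ha, ← ha, h1])
  have : Countable (Submodule.span ℤ (Set.range (latticeBasis L))).toAddSubgroup := by
    change Countable (Submodule.span ℤ (Set.range (latticeBasis L)))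
    infer_instance
  have hmain := measure_le_mul_of_multiplicity
    (ZSpan.isAddFundamentalDomain' (latticeBasis L) (volume : Measure (mixedSpace L))) hmeas _ hmult
  have hprod : ∏ w, f w ^ mult w = Real.toNNReal (R / 2) ^ finrank ℚ L := by
    rw [← sum_mult_eq, ← Finset.prod_pow_eq_pow_sum]
  rw [convexBodyLT_volume, hprod, volume_fundamentalDomain_latticeBasis] at hmain
  have h1 := ENNReal.toReal_mono (by finiteness) hmain
  simp only [ENNReal.toReal_mul, ENNReal.toReal_pow, ENNReal.coe_toReal,
    ENNReal.toReal_natCast, ENNReal.toReal_inv, ENNReal.toReal_ofNat, NNReal.coe_mul,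
    NNReal.coe_pow, NNReal.coe_ofNat, NNReal.coe_real_pi, 
    Real.coe_toNNReal _ (half_pos hR).le] at h1
  have h2 : ((NNReal.sqrt ‖discr L‖₊ : ℝ≥0) : ℝ) = Real.sqrt |(discr L : ℝ)| := by
    rw [Real.coe_sqrt, coe_nnnorm, Int.norm_eq_abs]
  rw [h2] at h1
  set M : ℝ := ((smallIntegers L R).ncard : ℝ)
  set S := Real.sqrt |(discr L : ℝ)|
  set r₁ := nrRealPlaces L
  set r₂ := nrComplexPlaces L
  have hN : finrank ℚ L = r₁ + 2 * r₂ := (card_add_two_mul_card_eq_rank L).symm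
  have h3 : (2 : ℝ) ^ r₂ ≤ Real.pi ^ r₂ := pow_le_pow_left₀ zero_le_two Real.two_le_pi _
  have h4 : (0 : ℝ) < 2 ^ r₂ := by positivity
  -- The box has volume 2^{r₁} π^{r₂} (R/2)^{r₁ + 2r₂} and the lattice covolume 2^{-r₂} √|D|; π ≥ 2
  -- lets all the constants cancel.
  calc R ^ finrank ℚ L = 2 ^ r₂ * (2 ^ r₁ * 2 ^ r₂ * (R / 2) ^ finrank ℚ L) := by
        rw [div_pow, hN, pow_add 2 r₁, pow_mul]
        field_simp
        rw [← pow_mul, ← pow_mul, mul_comm 2 r₂, pow_mul 2]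
    _ ≤ 2 ^ r₂ * (2 ^ r₁ * Real.pi ^ r₂ * (R / 2) ^ finrank ℚ L) := by gcongr
    _ ≤ 2 ^ r₂ * (M * (2⁻¹ ^ r₂ * S)) := by gcongr
    _ = M * S := by rw [inv_pow]; field_simp

end Multisymmetric

/-! ### Greedy bases of integers -/

namespace Multisymmetric

open Module NumberField

/-- The span of the first `j` members of a sequence of integers. -/
def flag (K : Type*) {L : Type*} [Field K] [Field L] [Algebra K L] (β : ℕ → 𝓞 L) (j : ℕ) :
    Submodule K L :=
  Submodule.span K ((fun i => (β i : L)) '' Set.Iio j)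

theorem flag_mono {K L : Type*} [Field K] [Field L] [Algebra K L] {β : ℕ → 𝓞 L} {i j : ℕ}
    (h : i ≤ j) : flag K β i ≤ flag K β j :=
  Submodule.span_mono (Set.image_mono (Set.Iio_subset_Iio h))

/-- Each member of the sequence has minimal house outside the span of the previous ones. -/
def IsGreedy (K : Type*) {L : Type*} [Field K] [Field L] [NumberField L] [Algebra K L]
    (β : ℕ → 𝓞 L) (n : ℕ) : Prop :=
  ∀ j < n, (β j : L) ∉ flag K β j ∧
    ∀ y : 𝓞 L, (y : L) ∉ flag K β j → house (β j : L) ≤ house (y : L)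

theorem IsGreedy.one_le_house {K L : Type*} [Field K] [Field L] [NumberField L] [Algebra K L]
    {β : ℕ → 𝓞 L} {n : ℕ} (hβ : IsGreedy K β n) {j : ℕ} (hj : j < n) :
    1 ≤ house (β j : L) := by
  refine one_le_house_of_isIntegral (β j).2 fun h => (hβ j hj).1 ?_
  rw [h]; exact Submodule.zero_mem _

theorem IsGreedy.linearIndepOn {K L : Type*} [Field K] [Field L] [NumberField L] [Algebra K L]
    {β : ℕ → 𝓞 L} {n : ℕ} (hβ : IsGreedy K β n) {j : ℕ} (hj : j ≤ n) :
    LinearIndepOn K (fun i => (β i : L)) (Set.Iio j) := by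
  induction j with
  | zero =>
    have : Set.Iio 0 = (∅ : Set ℕ) := by ext; simp
    rw [this]; exact linearIndepOn_empty K _
  | succ j ih =>
    have : Set.Iio (j + 1) = insert j (Set.Iio j) := by ext i; simp
    rw [this]
    exact (ih (by omega)).insert (hβ j hj).1

theorem IsGreedy.house_mono {K L : Type*} [Field K] [Field L] [NumberField L] [Algebra K L]
    {β : ℕ → 𝓞 L} {n : ℕ} (hβ : IsGreedy K β n) {i j : ℕ} (hij : i ≤ j) (hj : j < n) :
    house (β i : L) ≤ house (β j : L) :=
  (hβ i (by omega)).2 _ fun h => (hβ j hj).1 (flag_mono hij h)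

theorem IsGreedy.finrank_flag {K L : Type*} [Field K] [Field L] [NumberField L] [Algebra K L]
    {β : ℕ → 𝓞 L} {n : ℕ} (hβ : IsGreedy K β n) {j : ℕ} (hj : j ≤ n) :
    finrank K (flag K β j) = j := by
  have h := hβ.linearIndepOn hj
  have h1 := finrank_span_eq_card (R := K) (b := fun i : Set.Iio j => (β i : L)) h
  rw [flag, Set.image_eq_range, h1]
  simp

section basis

variable {K L : Type*} [Field K] [NumberField K] [Field L] [NumberField L] [Algebra K L]

theorem exists_integer_notMem {W : Submodule K L} (hW : W ≠ ⊤) : ∃ x : 𝓞 L, (x : L) ∉ W := by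
  obtain ⟨l, hl⟩ : ∃ l, l ∉ W := by
    by_contra! h
    exact hW (Submodule.eq_top_iff'.2 h)
  have halg : IsAlgebraic ℤ l :=
    (IsFractionRing.isAlgebraic_iff ℤ ℚ L).2 (Algebra.IsAlgebraic.isAlgebraic l)
  obtain ⟨y, hy, hi⟩ := halg.exists_integral_multiple
  refine ⟨⟨y • l, hi⟩, fun h => hl ?_⟩
  have h1 : (y : K)⁻¹ • (y • l) = l := by
    rw [← Int.cast_smul_eq_zsmul K, inv_smul_smul₀ (Int.cast_ne_zero.2 hy)]
  rw [← h1]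
  exact W.smul_mem _ h

theorem exists_minimal_integer_notMem {W : Submodule K L} (hW : W ≠ ⊤) :
    ∃ x : 𝓞 L, (x : L) ∉ W ∧ ∀ y : 𝓞 L, (y : L) ∉ W → house (x : L) ≤ house (y : L) := by
  obtain ⟨x₀, hx₀⟩ := exists_integer_notMem hW
  have hfin : {x : 𝓞 L | (x : L) ∉ W ∧ house (x : L) ≤ house (x₀ : L)}.Finite :=
    (finite_house_le L (house (x₀ : L))).subset fun x hx => hx.2
  obtain ⟨x, hx, hmin⟩ := Set.exists_min_image _ (fun x : 𝓞 L => house (x : L)) hfin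
    ⟨x₀, hx₀, le_rfl⟩
  refine ⟨x, hx.1, fun y hy => ?_⟩
  rcases le_total (house (y : L)) (house (x₀ : L)) with h | h
  · exact hmin y ⟨hy, h⟩
  · exact hx.2.trans h

variable (K L) in
theorem exists_isGreedy : ∃ β : ℕ → 𝓞 L, IsGreedy K β (finrank K L) := by
  classical
  have hm : ∀ W : Submodule K L, ∃ x : 𝓞 L, W ≠ ⊤ → (x : L) ∉ W ∧
      ∀ y : 𝓞 L, (y : L) ∉ W → house (x : L) ≤ house (y : L) := fun W => by
    by_cases h : W = ⊤
    · exact ⟨0, fun h' => absurd h h'⟩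
    · obtain ⟨x, hx⟩ := exists_minimal_integer_notMem h
      exact ⟨x, fun _ => hx⟩
  choose m hm using hm
  let G : ∀ j : ℕ, (∀ i < j, 𝓞 L) → 𝓞 L := fun j ih =>
    m (Submodule.span K {y | ∃ i, ∃ h : i < j, ((ih i h : 𝓞 L) : L) = y})
  let β : ℕ → 𝓞 L := fun j => Nat.strongRec G j
  have hβ : ∀ j, β j = m (flag K β j) := fun j => by
    have h1 : β j = G j (fun i _ => β i) := by
      simp only [β]
      rw [Nat.strongRec]
    rw [h1]
    simp only [G, flag]
    congr 2
    ext y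
    simp
  refine ⟨β, fun j hj => ?_⟩
  rw [hβ]
  apply hm
  intro htop
  have h1 : finrank K (flag K β j) ≤ j := by
    have h2 : flag K β j = Submodule.span K
        (((Finset.range j).image fun i => (β i : L) : Finset L) : Set L) := by
      rw [flag]; congr 1; ext; simp
    rw [h2]
    refine (finrank_span_finset_le_card _).trans (Finset.card_image_le.trans ?_)
    simp
  rw [htop, finrank_top] at h1
  omega

variable {β : ℕ → 𝓞 L} {n : ℕ}

/-- The spans of β_0, …, β_a and of β_0, …, β_b have dimensions adding up to n + 1. If all products
β_i β_j lay in a hyperplane ker φ, the two spans would be orthogonal for the nondegenerate pairing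
φ(xy), forcing the sum to be at most n. So some product lies outside the last flag, and minimality
of β_{n-1} applies. -/
theorem IsGreedy.house_le_mul (hβ : IsGreedy K β n) (hn : finrank K L = n) {a b : ℕ}
    (hab : a + b + 1 = n) : house (β (n - 1) : L) ≤ house (β a : L) * house (β b : L) := by
  obtain ⟨i, hi, j, hj, hij⟩ : ∃ i, i ≤ a ∧ ∃ j, j ≤ b ∧ (β i * β j : L) ∉ flag K β (n - 1) := by
    by_contra! hall
    have hlt : flag K β (n - 1) < ⊤ := by
      rw [lt_top_iff_ne_top]
      intro h
      have := hβ.finrank_flag (j := n - 1) (by omega)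
      rw [h, finrank_top] at this
      omega
    obtain ⟨φ, hφ, hker⟩ := Submodule.exists_le_ker_of_lt_top _ hlt
    have hmul : ∀ x ∈ flag K β (a + 1), ∀ y ∈ flag K β (b + 1), φ (x * y) = 0 := by
      intro x hx y hy
      rw [flag] at hx hy
      induction hx using Submodule.span_induction with
      | mem x hx =>
        obtain ⟨i, hi, rfl⟩ := hx
        induction hy using Submodule.span_induction with
        | mem y hy =>
          obtain ⟨j, hj, rfl⟩ := hy
          exact hker (hall i (Nat.lt_succ_iff.1 hi) j (Nat.lt_succ_iff.1 hj))
        | zero => simp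
        | add x y _ _ hx hy => rw [mul_add, map_add, hx, hy, add_zero]
        | smul c x _ hx => rw [mul_smul_comm, map_smul, hx, smul_zero]
      | zero => simp
      | add x y _ _ hx hy => rw [add_mul, map_add, hx, hy, add_zero]
      | smul c x _ hx => rw [smul_mul_assoc, map_smul, hx, smul_zero]
    let Ψ : L →ₗ[K] Dual K L := (LinearMap.mul K L).flip.compr₂ φ
    have hΨ : ∀ y x, Ψ y x = φ (x * y) := fun y x => rfl
    have hΨinj : Function.Injective Ψ := by
      rw [← LinearMap.ker_eq_bot, LinearMap.ker_eq_bot']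
      intro y hy
      by_contra hy0
      refine hφ (LinearMap.ext fun x => ?_)
      have := LinearMap.congr_fun hy (x * y⁻¹)
      rwa [hΨ, inv_mul_cancel_right₀ hy0] at this
    have hle : (flag K β (b + 1)).map Ψ ≤ (flag K β (a + 1)).dualAnnihilator := by
      rintro _ ⟨y, hy, rfl⟩
      rw [Submodule.mem_dualAnnihilator]
      exact fun x hx => hmul x hx y hy
    have h1 := Submodule.finrank_mono hle
    rw [← (Submodule.equivMapOfInjective Ψ hΨinj (flag K β (b + 1))).finrank_eq] at h1
    have h2 := Subspace.finrank_add_finrank_dualAnnihilator_eq (flag K β (a + 1))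
    rw [hβ.finrank_flag (by omega)] at h1 h2
    omega
  calc house (β (n - 1) : L) ≤ house ((β i * β j : 𝓞 L) : L) :=
        (hβ (n - 1) (by omega)).2 _ (by simpa using hij)
    _ ≤ house (β i : L) * house (β j : L) := by
        push_cast; exact house_mul_le _ _
    _ ≤ house (β a : L) * house (β b : L) :=
        mul_le_mul (hβ.house_mono hi (by omega)) (hβ.house_mono hj (by omega))
          (house_nonneg _) (house_nonneg _)

end basis

end Multisymmetric

/-! ### Bounding the largest house by the discriminant -/

namespace Multisymmetric

open Module NumberField

/-- The image of a rational vector space under an additive map to a real one spans a space of at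
most the same dimension. -/
theorem exists_submodule_of_map {V E : Type*} [AddCommGroup V] [Module ℚ V] [FiniteDimensional ℚ V]
    [NormedAddCommGroup E] [NormedSpace ℝ E] (ψ : V →+ E) :
    ∃ W : Submodule ℝ E, FiniteDimensional ℝ W ∧ finrank ℝ W ≤ finrank ℚ V ∧ ∀ v, ψ v ∈ W := by
  let b := finBasis ℚ V
  refine ⟨Submodule.span ℝ (Set.range fun i => ψ (b i)), ?_, ?_, fun v => ?_⟩
  · exact FiniteDimensional.span_of_finite ℝ (Set.finite_range _)
  · exact (finrank_range_le_card (R := ℝ) (fun i => ψ (b i))).trans_eq (Fintype.card_fin _)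
  · rw [← b.sum_repr v, map_sum]
    refine Submodule.sum_mem _ fun i _ => ?_
    have h1 : ψ (b.repr v i • b i) = ((b.repr v i : ℚ) : ℝ) • ψ (b i) := by
      exact map_ratCast_smul ψ ℚ ℝ (b.repr v i) (b i)
    rw [h1]
    exact Submodule.smul_mem _ _ (Submodule.subset_span ⟨i, rfl⟩)

theorem mul_le_of_step {A B P u v T₁ T₂ T₃ R : ℝ} (hu : 0 < u) (hP : 0 ≤ P) (hR : 0 ≤ R)
    (hT₁ : 0 ≤ T₁) (hT₃ : 0 ≤ T₃) (h₁ : A * (u * v) ≤ T₁ * R * B)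
    (h₂ : B * P ≤ T₃ * u) (h₃ : T₁ ≤ T₂) : A * (P * v) ≤ T₃ * T₂ * R := by
  refine le_of_mul_le_mul_right ?_ hu
  calc A * (P * v) * u = (A * (u * v)) * P := by ring
    _ ≤ (T₁ * R * B) * P := mul_le_mul_of_nonneg_right h₁ hP
    _ = T₁ * R * (B * P) := by ring
    _ ≤ T₁ * R * (T₃ * u) := mul_le_mul_of_nonneg_left h₂ (mul_nonneg hT₁ hR)
    _ ≤ T₂ * R * (T₃ * u) := by gcongr
    _ = T₃ * T₂ * R * u := by ring

theorem mul_le_of_count {A P S T T' w x : ℝ} (hx : 0 < x) (hP : 0 ≤ P) (hS : 0 ≤ S)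
    (h₁ : w * x ≤ A * S) (h₂ : A * P ≤ T * x) (h₃ : T ≤ T') : P * w ≤ T' * S := by
  refine le_of_mul_le_mul_right ?_ hx
  calc P * w * x = P * (w * x) := by ring
    _ ≤ P * (A * S) := mul_le_mul_of_nonneg_left h₁ hP
    _ = (A * P) * S := by ring
    _ ≤ (T * x) * S := mul_le_mul_of_nonneg_right h₂ hS
    _ ≤ (T' * x) * S := by gcongr
    _ = T' * S * x := by ring

variable {K L : Type*} [Field K] [NumberField K] [Field L] [NumberField L] [Algebra K L]
  {β : ℕ → 𝓞 L} {n : ℕ}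

/-- By minimality, every integer of house less than that of β_{j+1} lies in the span of β_0, …, β_j,
of ℚ-dimension d(j + 1). Packing in its real span compares the two counts. -/
theorem IsGreedy.ncard_smallIntegers_succ_le (hβ : IsGreedy K β n) {j : ℕ} (hj : j + 1 < n) :
    ((smallIntegers L (house (β (j + 1) : L))).ncard : ℝ) * house (β j : L) ^ (finrank ℚ K * (j + 1))
      ≤ (3 * house (β (j + 1) : L)) ^ (finrank ℚ K * (j + 1)) *
        (smallIntegers L (house (β j : L))).ncard := by
  set R := house (β (j + 1) : L) with hR
  set δ := house (β j : L) with hδ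
  have hδ1 : 1 ≤ δ := hβ.one_le_house (by omega)
  have hδR : δ ≤ R := hβ.house_mono (by omega) (by omega)
  let ψ : L →+ ((L →+* ℂ) → ℂ) := (canonicalEmbedding L).toAddMonoidHom
  let ψ' : 𝓞 L →+ ((L →+* ℂ) → ℂ) := ψ.comp (algebraMap (𝓞 L) L).toAddMonoidHom
  let V : Submodule ℚ L := (flag K β (j + 1)).restrictScalars ℚ
  obtain ⟨W, hW, hWV, hψ⟩ := exists_submodule_of_map (ψ.comp V.subtype.toAddMonoidHom)
  have hV : finrank ℚ V = finrank ℚ K * (j + 1) := by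
    have h1 : finrank ℚ K * finrank K (flag K β (j + 1)) = finrank ℚ (flag K β (j + 1)) :=
      finrank_mul_finrank ℚ K (flag K β (j + 1))
    rw [hβ.finrank_flag (by omega)] at h1
    exact h1.symm
  have key := ncard_mul_pow_le ψ' W (finite_smallIntegers L R) (R := R) (δ := δ) (by linarith)
    (by linarith) (by
      intro x hx
      have hxV : (x : L) ∈ flag K β (j + 1) := by
        by_contra h
        exact absurd ((hβ (j + 1) hj).2 x h) (not_le.2 hx)
      exact hψ ⟨x, hxV⟩) (fun x hx => le_of_lt hx) (finite_smallIntegers L δ)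
  have hB : {x | ‖ψ' x‖ < δ} = smallIntegers L δ := rfl
  rw [hB] at key
  set D := finrank ℝ W
  set N := finrank ℚ K * (j + 1)
  -- The real span may have dimension below N; the missing factors are supplied by δ ≤ 3R.
  obtain ⟨t, ht⟩ : ∃ t, N = D + t := ⟨N - D, by omega⟩
  rw [ht, pow_add, pow_add, ← mul_assoc]
  have h2 : (2 * R + δ) ^ D ≤ (3 * R) ^ D :=
    pow_le_pow_left₀ (by linarith) (by linarith) _
  have h3 : δ ^ t ≤ (3 * R) ^ t := pow_le_pow_left₀ (by linarith) (by linarith) _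
  have h4 : 0 ≤ (3 * R) ^ D := pow_nonneg (by linarith) _
  have h5 : 0 ≤ δ ^ t := pow_nonneg (by linarith) _
  calc _ ≤ ((2 * R + δ) ^ D * (smallIntegers L δ).ncard) * δ ^ t := by gcongr
    _ ≤ ((3 * R) ^ D * (smallIntegers L δ).ncard) * (3 * R) ^ t := by gcongr
    _ = _ := by rw [mul_right_comm]

/-- The step estimates telescope, starting from the fact that no nonzero integer has house less than
that of β_0. -/
theorem IsGreedy.ncard_mul_prod_le (hβ : IsGreedy K β n) {j : ℕ} (hj : j < n) :
    ((smallIntegers L (house (β j : L))).ncard : ℝ) *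
      ∏ i ∈ Finset.range j, house (β i : L) ^ finrank ℚ K ≤
      3 ^ (finrank ℚ K * n * j) * house (β j : L) ^ (finrank ℚ K * j) := by
  induction j with
  | zero =>
    have h1 : smallIntegers L (house (β 0 : L)) ⊆ {0} := by
      intro x hx
      by_contra h
      refine absurd ((hβ 0 hj).2 x fun hm => h ?_) (not_le.2 hx)
      have h2 : flag K β 0 = ⊥ := by
        rw [flag]
        have : Set.Iio 0 = (∅ : Set ℕ) := by ext; simp
        rw [this]; simp
      rw [h2, Submodule.mem_bot] at hm
      simpa using hm
    have h2 := Set.ncard_le_ncard h1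
    rw [Set.ncard_singleton] at h2
    simpa using h2
  | succ j ih =>
    have ih := ih (by omega)
    have hstep := hβ.ncard_smallIntegers_succ_le hj
    set d := finrank ℚ K
    set R := house (β (j + 1) : L)
    set δ := house (β j : L) with hδ
    set A : ℝ := ((smallIntegers L R).ncard : ℝ)
    set B : ℝ := ((smallIntegers L δ).ncard : ℝ)
    set P := ∏ i ∈ Finset.range j, house (β i : L) ^ d
    have hP : 0 ≤ P := Finset.prod_nonneg fun i _ => pow_nonneg (house_nonneg _) _
    have hR : 0 ≤ R := house_nonneg _
    have hδ0 : 0 < δ := by have := hβ.one_le_house (j := j) (by omega); linarith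
    rw [Finset.prod_range_succ, ← hδ]
    have h3 : (3 : ℝ) ^ (d * (j + 1)) ≤ 3 ^ (d * n) :=
      pow_le_pow_right₀ (by norm_num) (Nat.mul_le_mul_left d (by omega))
    rw [mul_pow, Nat.mul_succ d j, pow_add δ, ← Nat.mul_succ] at hstep
    rw [Nat.mul_succ (d * n) j, pow_add]
    exact mul_le_of_step (pow_pos hδ0 _) hP (pow_nonneg hR _) (pow_nonneg (by norm_num) _)
      (pow_nonneg (by norm_num) _) hstep ih h3

/-- Combined with the lower bound for the number of small integers, the telescoped estimate bounds ∏
house(β_i)^d by 3^{dn²} √|D|. Squaring and pairing β_i with β_{n-1-i} gives n factors, each at least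
house(β_{n-1})^d. -/
theorem IsGreedy.house_pow_le (hβ : IsGreedy K β n) (hn : finrank K L = n) :
    house (β (n - 1) : L) ^ (finrank ℚ K * n) ≤ 9 ^ (finrank ℚ K * n * n) * |(discr L : ℝ)| := by
  have hn0 : 0 < n := hn ▸ finrank_pos
  have hj : n - 1 < n := by omega
  have h1 := hβ.ncard_mul_prod_le hj
  have hμ1 := hβ.one_le_house hj
  have h2 := pow_le_ncard_smallIntegers L (R := house (β (n - 1) : L)) (by linarith)
  rw [← finrank_mul_finrank ℚ K L, hn] at h2
  set d := finrank ℚ K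
  set μ := house (β (n - 1) : L) with hμ
  set A : ℝ := ((smallIntegers L μ).ncard : ℝ)
  set S := Real.sqrt |(discr L : ℝ)|
  have hS : 0 ≤ S := Real.sqrt_nonneg _
  have hμ0 : 0 < μ := by linarith
  set P := ∏ i ∈ Finset.range (n - 1), house (β i : L) ^ d
  have hP : 0 ≤ P := Finset.prod_nonneg fun i _ => pow_nonneg (house_nonneg _) _
  -- the product of all houses
  have h3 : ∏ i ∈ Finset.range n, house (β i : L) ^ d = P * μ ^ d := by
    conv_lhs => rw [show n = (n - 1) + 1 by omega, Finset.prod_range_succ]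
  have h4 : P * μ ^ d ≤ 3 ^ (d * n * n) * S := by
    refine mul_le_of_count (pow_pos hμ0 (d * (n - 1))) hP hS ?_ h1
      (pow_le_pow_right₀ (by norm_num) (Nat.mul_le_mul_left _ (by omega)))
    rw [← pow_add]
    refine le_of_eq_of_le ?_ h2
    congr 1
    conv_rhs => rw [show n = 1 + (n - 1) by omega]
    rw [Nat.mul_add, mul_one]
  have h5 : (μ ^ d) ^ n ≤ (P * μ ^ d) * (P * μ ^ d) := by
    have hr := Finset.prod_range_reflect (fun i => house (β i : L) ^ d) n
    rw [← h3]
    nth_rewrite 2 [← hr]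
    rw [← Finset.prod_mul_distrib]
    calc (μ ^ d) ^ n = ∏ _i ∈ Finset.range n, μ ^ d := by simp
      _ ≤ _ := by
        refine Finset.prod_le_prod (fun i _ => by positivity) fun i hi => ?_
        rw [Finset.mem_range] at hi
        rw [← mul_pow]
        exact pow_le_pow_left₀ hμ0.le (hβ.house_le_mul hn (by omega)) _
  calc μ ^ (d * n) = (μ ^ d) ^ n := pow_mul _ _ _
    _ ≤ (P * μ ^ d) * (P * μ ^ d) := h5
    _ ≤ (3 ^ (d * n * n) * S) * (3 ^ (d * n * n) * S) :=
        mul_le_mul h4 h4 (mul_nonneg hP (pow_nonneg hμ0.le _))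
          (mul_nonneg (pow_nonneg (by norm_num) _) hS)
    _ = 9 ^ (d * n * n) * |(discr L : ℝ)| := by
        have h6 : S * S = |(discr L : ℝ)| := Real.mul_self_sqrt (abs_nonneg _)
        rw [← h6, show (9 : ℝ) = 3 * 3 by norm_num, mul_pow, mul_mul_mul_comm]

/-- A number field extension has a basis of integers of small house. -/
theorem exists_small_basis (K L : Type*) [Field K] [NumberField K] [Field L] [NumberField L]
    [Algebra K L] {n : ℕ} (hn2 : 2 < n) (hn : finrank K L = n) :
    ∃ β : Fin n → 𝓞 L, LinearIndependent K (fun i => (β i : L)) ∧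
      ∀ i, house (β i : L) ≤ 9 ^ n * |(discr L : ℝ)| ^ (1 / ((finrank ℚ K : ℝ) * ((n : ℝ) - 2))) := by
  obtain ⟨β, hβ⟩ := exists_isGreedy K L
  rw [hn] at hβ
  refine ⟨fun i => β i, ?_, fun i => (hβ.house_mono (j := n - 1) (by omega) (by omega)).trans ?_⟩
  · have h1 := hβ.linearIndepOn le_rfl
    exact h1.comp (fun i : Fin n => (⟨i, i.2⟩ : Set.Iio n)) fun i j h => by
      exact Fin.ext (congrArg Subtype.val h)
  · have h1 := hβ.house_pow_le hn
    have hd : 0 < finrank ℚ K := finrank_pos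
    set d := finrank ℚ K
    set μ := house (β (n - 1) : L)
    have hD : 1 ≤ |(discr L : ℝ)| := by
      have := Int.one_le_abs (discr_ne_zero L)
      exact_mod_cast this
    have hdn : ((d * n : ℕ) : ℝ) ≠ 0 := by positivity
    have hn2' : (2 : ℝ) < n := by exact_mod_cast hn2
    have hd' : (0 : ℝ) < d := by exact_mod_cast hd
    have h2 : μ ≤ 9 ^ n * |(discr L : ℝ)| ^ (1 / ((d * n : ℕ) : ℝ)) := by
      refine le_of_pow_le_pow_left₀ (n := d * n) (by positivity) (by positivity) (h1.trans_eq ?_)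
      rw [mul_pow, ← pow_mul, ← Real.rpow_natCast (_ ^ (1 / ((d * n : ℕ) : ℝ))),
        ← Real.rpow_mul (by positivity), one_div_mul_cancel hdn, Real.rpow_one]
      congr 2
      ring
    -- The argument gives the exponent 1/(dn), which is weakened to 1/(d(n - 2)) using |D| ≥ 1.
    refine h2.trans ?_
    have h3 : (0 : ℝ) < n - 2 := by linarith
    refine mul_le_mul_of_nonneg_left (Real.rpow_le_rpow_of_exponent_le hD ?_) (by positivity)
    rw [Nat.cast_mul]
    exact one_div_le_one_div_of_le (mul_pos hd' h3)
      (mul_le_mul_of_nonneg_left (by linarith) hd'.le)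

end Multisymmetric

/-! ### Avoiding a hypersurface with small coefficients -/

namespace Multisymmetric

open Module NumberField MvPolynomial

theorem totalDegree_aeval_le {σ τ A B : Type*} [CommRing A] [CommRing B] [Algebra A B] [Fintype σ]
    (P : MvPolynomial σ A) {g : σ → MvPolynomial τ B} (hg : ∀ i, (g i).totalDegree ≤ 1) :
    (aeval g P).totalDegree ≤ P.totalDegree := by
  rw [aeval_def, eval₂_eq']
  refine totalDegree_finsetSum_le fun d hd => ?_
  have h1 : (algebraMap A (MvPolynomial τ B) (coeff d P)).totalDegree = 0 := by
    rw [IsScalarTower.algebraMap_apply A B (MvPolynomial τ B), algebraMap_eq, totalDegree_C]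
  refine (totalDegree_mul _ _).trans ?_
  rw [h1, zero_add]
  refine (totalDegree_finsetProd _ _).trans (le_trans ?_ (le_totalDegree hd))
  rw [Finsupp.sum_fintype _ _ (by simp)]
  refine Finset.sum_le_sum fun i _ => (totalDegree_pow _ _).trans ?_
  exact (Nat.mul_le_mul_left _ (hg i)).trans_eq (mul_one _)

/-- A nonzero polynomial does not vanish at all small integral combinations of the rows of an
invertible matrix. -/
theorem exists_nat_aeval_ne_zero {n r : ℕ} {P : MvPolynomial (Fin n × Fin r) ℚ} (hP : P ≠ 0)
    {F : Type*} [Field F] [Algebra ℚ F] {M : Matrix (Fin n) (Fin n) F} (hM : IsUnit M) :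
    ∃ a : Fin n × Fin r → ℕ, (∀ lk, a lk ≤ P.totalDegree) ∧
      aeval (fun ik : Fin n × Fin r => ∑ l, M ik.1 l * (a (l, ik.2) : F)) P ≠ 0 := by
  classical
  have : CharZero F := algebraRat.charZero F
  have : Infinite F := CharZero.infinite F
  let g : Fin n × Fin r → MvPolynomial (Fin n × Fin r) F :=
    fun ik => ∑ l, C (M ik.1 l) * X (l, ik.2)
  have hg : ∀ ik, (g ik).totalDegree ≤ 1 := fun ik => by
    refine totalDegree_finsetSum_le fun l _ => (totalDegree_mul _ _).trans ?_
    simp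
  have heval : ∀ b : Fin n × Fin r → F, eval b (aeval g P) =
      aeval (fun ik : Fin n × Fin r => ∑ l, M ik.1 l * b (l, ik.2)) P := fun b => by
    have h1 : eval b (aeval g P) = aeval (fun ik => aeval b (g ik)) P := by
      have := congrArg (fun φ => φ P) (comp_aeval (R := ℚ) g
      ((aeval b : MvPolynomial _ F →ₐ[F] F).restrictScalars ℚ))
      simpa [aeval_eq_eval] using this
    rw [h1]
    congr 2
    funext ik
    simp [g]
  have hQ : aeval g P ≠ 0 := by
    obtain ⟨y, hy⟩ : ∃ y : Fin n × Fin r → F, aeval y P ≠ 0 := by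
      by_contra! h
      apply hP
      apply map_injective (algebraMap ℚ F) (algebraMap ℚ F).injective
      rw [map_zero]
      apply MvPolynomial.funext
      intro y
      rw [eval_map, map_zero]
      exact h y
    intro h0
    apply hy
    -- Since M is invertible, every point y is attained after the substitution, so the substituted
    -- polynomial is nonzero.
    have h1 := heval fun lk => ∑ i, M⁻¹ lk.1 i * y (i, lk.2)
    rw [h0, map_zero] at h1
    rw [h1]
    congr 2
    funext ik
    have h2 : M.mulVec (M⁻¹.mulVec fun i => y (i, ik.2)) = fun i => y (i, ik.2) := by
      rw [Matrix.mulVec_mulVec, Matrix.mul_nonsing_inv _ ((Matrix.isUnit_iff_isUnit_det M).1 hM),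
        Matrix.one_mulVec]
    exact (congrFun h2 ik.1).symm
  by_contra! hall
  apply hQ
  -- A polynomial vanishing on a grid with more than its degree many values in each variable is
  -- zero; the linear substitution does not raise the total degree.
  refine eq_zero_of_eval_zero_at_prod_finset _
    (fun _ => (Finset.range (P.totalDegree + 1)).image (Nat.cast : ℕ → F)) (fun i => ?_)
    fun x hx => ?_
  · rw [Finset.card_image_of_injective _ Nat.cast_injective, Finset.card_range]
    exact Nat.lt_succ_of_le ((degreeOf_le_totalDegree _ i).trans (totalDegree_aeval_le P hg))
  · simp only [Finset.mem_image, Finset.mem_range] at hx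
    choose a ha hax using hx
    rw [heval]
    simp only [← hax]
    exact hall a fun lk => Nat.lt_succ_iff.1 (ha lk)

/-- Dedekind's independence of embeddings, evaluated on a basis. -/
theorem isUnit_embeddings_matrix {n : ℕ} {K L F : Type*} [Field K] [Field L] [Algebra K L]
    [FiniteDimensional K L] [Field F] [Algebra K F] (hn : finrank K L = n)
    (ρ : Fin n ≃ (L →ₐ[K] F)) {b : Fin n → L} (hb : LinearIndependent K b) :
    IsUnit (Matrix.of fun i l => ρ i (b l)) := by
  rw [← Matrix.linearIndependent_rows_iff_isUnit, Fintype.linearIndependent_iff]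
  intro c hc
  have h1 : LinearIndependent F fun i => (ρ i).toLinearMap :=
    (linearIndependent_toLinearMap K L F).comp ρ ρ.injective
  refine Fintype.linearIndependent_iff.1 h1 c ?_
  let B := basisOfLinearIndependentOfCardEqFinrank' b hb (by simp [hn])
  refine B.ext fun l => ?_
  have h2 := congrFun hc l
  simpa [B] using h2

theorem F_apply_f {n r : ℕ} {S : Set (Fin r → ℕ)} {A : Type*} [CommRing A] (x : Pts n r A)
    {τ : Fin r → ℕ} (hτ : τ ∈ S) :
    F S x ⟨f n τ, Subring.subset_closure ⟨τ, hτ, rfl⟩⟩ = ∑ i, mon τ fun k => x k i := by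
  simp [F, f, tr, chi, genericPt, mon]

end Multisymmetric

/-! ### Assembling the theorem -/

namespace Multisymmetric

open Module NumberField MvPolynomial

theorem exists_finset_of_lt_two_mul_encard {n r : ℕ} {S S₀ S₁ : Set (Fin r → ℕ)}
    (h₀ : (n : ℕ∞) < 2 * S₀.encard) (h₁ : S₀ + S₀ ⊆ S₁) (h₂ : S₁ + S₁ ⊆ S)
    (h₃ : ∀ k : Fin r, ∀ σ ∈ S₁, σ + Pi.single k 1 ∈ S) :
    ∃ T : Finset (Fin r → ℕ), T.card = n / 2 + 1 ∧
      ∀ τ ∈ T + T, ∀ τ' ∈ sumset T, τ + τ' ∈ S := by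
  have hle : ((n / 2 + 1 : ℕ) : ℕ∞) ≤ S₀.encard := by
    rcases eq_or_ne S₀.encard ⊤ with h | h
    · simp [h]
    · lift S₀.encard to ℕ using h with m hm
      norm_cast at h₀ ⊢
      omega
  obtain ⟨T', hT', hc⟩ := Set.exists_subset_encard_eq hle
  have hfin : T'.Finite := Set.finite_of_encard_eq_coe hc
  lift T' to Finset (Fin r → ℕ) using hfin
  rw [Set.encard_coe_eq_coe_finsetCard, Nat.cast_inj] at hc
  have hmem : ∀ τ ∈ T' + T', τ ∈ S₁ := fun τ hτ => by
    obtain ⟨c, hc, c', hc', rfl⟩ := Finset.mem_add.1 hτ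
    exact h₁ (Set.add_mem_add (hT' hc) (hT' hc'))
  refine ⟨T', hc, fun τ hτ τ' hτ' => ?_⟩
  rcases mem_sumset_iff.1 hτ' with ⟨c, hc, c', hc', rfl⟩ | ⟨k, rfl⟩
  · exact h₂ (Set.add_mem_add (hmem _ hτ) (hmem _ (Finset.add_mem_add hc hc')))
  · exact h₃ k _ (hmem _ hτ)

/-- If the moments on `S` determine a point up to permutation, then its fiber is small. -/
theorem encard_fiber_le {n r : ℕ} (hr : r ≠ 0) {S : Set (Fin r → ℕ)} {A : Type*} [CommRing A]
    {z : Pts n r A}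
    (hz : ∀ x : Pts n r A, (∀ τ ∈ S, ∑ i, mon τ (fun k => z k i) = ∑ i, mon τ fun k => x k i) →
      ∃ π : Equiv.Perm (Fin n), ∀ j k, x k j = z k (π j)) :
    {x : Pts n r A | F S x = F S z}.encard ≤ ((n.factorial ^ r : ℕ) : ℕ∞) := by
  have hsub : {x : Pts n r A | F S x = F S z} ⊆
      Set.range fun (π : Equiv.Perm (Fin n)) k j => z k (π j) := by
    intro x hx
    obtain ⟨π, hπ⟩ := hz x fun τ hτ => by rw [← F_apply_f z hτ, ← F_apply_f x hτ, hx]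
    exact ⟨π, by funext k j; exact (hπ j k).symm⟩
  refine (Set.encard_le_encard hsub).trans ?_
  rw [← Set.image_univ]
  refine (Set.encard_image_le _ _).trans ?_
  rw [Set.encard_univ, ENat.card_eq_coe_fintype_card, Fintype.card_perm, Fintype.card_fin]
  -- The fiber has at most n! points, one per permutation; r ≠ 0 gives n! ≤ (n!)^r.
  exact_mod_cast Nat.le_self_pow hr _

theorem adjoin_range_eq_top {n r : ℕ} {K L E : Type*} [Field K] [Field L] [Algebra K L]
    [FiniteDimensional K L] [CharZero K] [Field E] [Algebra K E] [IsAlgClosed E]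
    (ρ : Fin n ≃ (L →ₐ[K] E)) {α : Fin r → L} {k : Fin r} (h : ∀ i j, i ≠ j → ρ i (α k) ≠ ρ j (α k)) :
    IntermediateField.adjoin K (Set.range α) = ⊤ := by
  have h1 : IntermediateField.adjoin K {α k} = ⊤ := by
    rw [Field.primitive_element_iff_algHom_eq_of_eval' K E (fun x => IsAlgClosed.splits _)]
    intro φ ψ hφ
    by_contra hne
    refine h (ρ.symm φ) (ρ.symm ψ) (fun h' => hne (ρ.symm.injective h')) ?_
    simpa using hφ
  rw [eq_top_iff, ← h1]
  exact IntermediateField.adjoin.mono _ _ _ (by simp)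

theorem house_sum_natCast_mul_le {n D : ℕ} {L : Type*} [Field L] [NumberField L]
    {a : Fin n → ℕ} (ha : ∀ l, a l ≤ D) {β : Fin n → L} {B : ℝ} (hβ : ∀ l, house (β l) ≤ B) :
    house (∑ l, (a l : L) * β l) ≤ n * D * B := by
  refine (house_sum_le_sum_house _ _).trans ?_
  calc ∑ l, house ((a l : L) * β l) ≤ ∑ _l : Fin n, D * B := by
        refine Finset.sum_le_sum fun l _ => ?_
        rw [house_nat_mul]
        have : (a l : ℝ) ≤ D := by exact_mod_cast ha l
        exact mul_le_mul this (hβ l) (house_nonneg _) (by positivity)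
    _ = n * D * B := by simp [mul_assoc]

/-- The extra factor makes the k-th coordinates distinct, so that the k-th integer alone will
generate L over K. -/
theorem exists_generic_determined_ne {n r : ℕ} (hn : 2 < n) {T : Finset (Fin r → ℕ)}
    (hT : T.card = n / 2 + 1) (k : Fin r) :
    ∃ P : MvPolynomial (Fin n × Fin r) ℚ, P ≠ 0 ∧
      ∀ {E : Type*} [Field E] [Algebra ℚ E] (x : Fin n → Fin r → E),
        aeval (fun ik => x ik.1 ik.2) P ≠ 0 →
        (∀ i j, i ≠ j → x i k ≠ x j k) ∧
        ∀ y : Fin n → Fin r → E,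
          (∀ τ ∈ T + T, ∀ τ' ∈ sumset T, ∑ i, mon (τ + τ') (x i) = ∑ i, mon (τ + τ') (y i)) →
          ∃ π : Equiv.Perm (Fin n), ∀ j, y j = x (π j) := by
  obtain ⟨P, hP, h⟩ := exists_generic_determined hn hT
  let Q : MvPolynomial (Fin n × Fin r) ℚ :=
    ∏ ij ∈ Finset.univ.filter fun ij : Fin n × Fin n => ij.1 ≠ ij.2, (X (ij.1, k) - X (ij.2, k))
  refine ⟨P * Q, mul_ne_zero hP (Finset.prod_ne_zero_iff.2 fun ij hij => ?_), ?_⟩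
  · refine sub_ne_zero.2 fun h' => (Finset.mem_filter.1 hij).2 ?_
    simpa using X_injective h'
  · intro E _ _ x hx
    rw [map_mul, map_prod] at hx
    refine ⟨fun i j hij => ?_, fun y => h x y (left_ne_zero_of_mul hx)⟩
    have := Finset.prod_ne_zero_iff.1 (right_ne_zero_of_mul hx) (i, j) (by simp [hij])
    simpa [sub_eq_zero] using this

end Multisymmetric

theorem proposition2p5 (n r : ℕ) (hn : 2 < n) (S : Set (Fin r → ℕ)) :
    ∃ C : ℝ, 0 < C ∧
      ∀ S₀ S₁ : Set (Fin r → ℕ),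
        (n : ℕ∞) < 2 * S₀.encard →
        S₀ + S₀ ⊆ S₁ →
        S₁ + S₁ ⊆ S →
        (∀ k : Fin r, ∀ σ ∈ S₁, σ + Pi.single k 1 ∈ S) →
        ∀ (K L Kbar : Type*) [Field K] [NumberField K] [Field L] [NumberField L] [Algebra K L]
          [Field Kbar] [Algebra K Kbar] [IsAlgClosure K Kbar],
          Module.finrank K L = n →
          ∃ α : Fin r → NumberField.RingOfIntegers L,
            (∀ k, NumberField.house (α k : L) ≤
              C * |(NumberField.discr L : ℝ)| ^
                (1 / ((Module.finrank ℚ K : ℝ) * ((n : ℝ) - 2)))) ∧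
            (∀ ρ : Fin n ≃ (L →ₐ[K] Kbar),
              {x : Multisymmetric.Pts n r Kbar |
                Multisymmetric.F S x =
                  Multisymmetric.F S (Multisymmetric.phi ρ α)}.encard ≤
                ((n.factorial ^ r : ℕ) : ℕ∞)) ∧
            IntermediateField.adjoin K (Set.range fun k => (α k : L)) = ⊤ := by
  open Multisymmetric in
  -- The constant precedes Σ₀ and Σ₁, so T is chosen from Σ alone. If no such T exists, no
  -- admissible pair Σ₀, Σ₁ exists either.
  by_cases hex : ∃ T : Finset (Fin r → ℕ), T.card = n / 2 + 1 ∧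
      ∀ τ ∈ T + T, ∀ τ' ∈ sumset T, τ + τ' ∈ S
  swap
  · exact ⟨1, one_pos, fun S₀ S₁ h₀ h₁ h₂ h₃ =>
      (hex (exists_finset_of_lt_two_mul_encard h₀ h₁ h₂ h₃)).elim⟩
  obtain ⟨T, hT, hTS⟩ := hex
  have hr : r ≠ 0 := by
    rintro rfl
    have := Finset.card_le_univ T
    simp at this
    omega
  let k₀ : Fin r := ⟨0, Nat.pos_of_ne_zero hr⟩
  obtain ⟨P, hP, hdet⟩ := exists_generic_determined_ne hn hT k₀
  -- Each α_k is a sum of n terms with coefficients at most deg P and basis elements bounded with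
  -- constant 9^n; the 1 ensures positivity.
  refine ⟨n * P.totalDegree * 9 ^ n + 1, by positivity, ?_⟩
  intro _ _ _ _ _ _ K L E _ _ _ _ _ _ _ _ hKL
  have : IsAlgClosed E := IsAlgClosure.isAlgClosed K
  have : CharZero E := charZero_of_injective_algebraMap (algebraMap K E).injective
  have : FiniteDimensional K L := Module.finite_of_finrank_pos (by omega)
  obtain ⟨β, hβ, hβB⟩ := exists_small_basis K L hn hKL
  obtain ⟨ρ₀⟩ : Nonempty (Fin n ≃ (L →ₐ[K] E)) :=
    ⟨(finCongr (by rw [AlgHom.card K L E, hKL])).trans (Fintype.equivFin (L →ₐ[K] E)).symm⟩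
  obtain ⟨a, ha, haP⟩ := exists_nat_aeval_ne_zero hP (isUnit_embeddings_matrix hKL ρ₀ hβ)
  let α : Fin r → NumberField.RingOfIntegers L := fun k =>
    ∑ l, (a (l, k) : NumberField.RingOfIntegers L) * β l
  have hα : ∀ k, (α k : L) = ∑ l, (a (l, k) : L) * (β l : L) := fun k => by simp [α]
  have hρα : ∀ (ρ : L →ₐ[K] E) k, ρ (α k : L) = ∑ l, ρ (β l : L) * (a (l, k) : E) := fun ρ k => by
    simp [hα, mul_comm]
  have hx := hdet (fun i k => ρ₀ i (α k : L)) (by simpa only [hρα, Matrix.of_apply] using haP)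
  refine ⟨α, fun k => ?_, fun ρ => ?_, adjoin_range_eq_top ρ₀ (k := k₀) hx.1⟩
  · rw [hα]
    refine (house_sum_natCast_mul_le (fun l => ha (l, k)) hβB).trans ?_
    rw [← mul_assoc]
    exact mul_le_mul_of_nonneg_right (le_add_of_nonneg_right zero_le_one) (by positivity)
  · refine encard_fiber_le hr fun x hxz => ?_
    -- P is known to be nonzero only for the numbering ρ₀; any other numbering permutes the rows and
    -- leaves the moments unchanged.
    let e : Equiv.Perm (Fin n) := ρ.trans ρ₀.symm
    have he : ∀ i k, phi ρ α k i = ρ₀ (e i) (α k : L) := fun i k => by simp [phi, e]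
    obtain ⟨π, hπ⟩ := hx.2 (fun i k => x k i) fun τ hτ τ' hτ' => by
      rw [← hxz _ (hTS τ hτ τ' hτ')]
      simp only [he]
      exact (Equiv.sum_comp e fun i => mon (τ + τ') fun k => ρ₀ i (α k : L)).symm
    refine ⟨π.trans e.symm, fun j k => ?_⟩
    rw [he]
    simpa using congrFun (hπ j) k
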